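/- Let $(\mathcal X,\mathcal A,\mu)$ be a $\sigma$-finite measure space and let $\{f_\theta:\theta\in\Theta\}$, $\Theta\subseteq\mathbb R^p$ open, be an identifiable family of probability densities with respect to $\mu$. Let $\beta\ge 0$ and put $$V_\theta(x)=\int f_\theta^{1+\beta}\,d\mu-\Bigl(1+\frac1\beta\Bigr)f_\theta^\beta(x)\quad(\beta>0),\qquad V_\theta(x)=-\log f_\theta(x)\quad(\beta=0).$$ Let $r<p$ and let $g:\mathbb R^p\to\mathbb R^r$ have on $\Theta$ a continuous $p\times r$ derivative matrix $G(\theta)=\partial g^T(\theta)/\partial\theta$ of rank $r$. Let $\Theta_0=\{\theta\in\Theta: g(\theta)=0\}$, let $\theta_0\in\Theta_0$, and let $X_1,X_2,\dots$ be i.i.d. with density $f_{\theta_0}$. Let $u_\theta(x)=\frac{\partial}{\partial\theta}\log f_\theta(x)$ and $$J_\beta(\theta)=\int u_\theta u_\theta^T f_\theta^{1+\beta}\,d\mu,\qquad \xi_\beta(\theta)=\int u_\theta f_\theta^{1+\beta}\,d\mu,\qquad K_\beta(\theta)=\int u_\theta u_\theta^T f_\theta^{1+2\beta}\,d\mu-\xi_\beta(\theta)\xi_\beta(\theta)^T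 .$$ Assume the Lehmann and Basu et al. conditions: 1. The support $\{x: f_\theta(x)>0\}$ is the same for all $\theta\in\Theta$. 2. There is an open set $\omega\subseteq\Theta$ containing $\theta_0$ such that, for almost all $x$ in the support, $\theta\mapsto f_\theta(x)$ is three times differentiable on $\omega$ with continuous third partial derivatives. 3. On $\omega$, the integrals $\int f_\theta^{1+\beta}\,d\mu$ and $\int f_\theta^{\beta}f_{\theta_0}\,d\mu$ exist and can be differentiated three times with respect to $\theta$, and the derivatives can be taken under the integral sign. 4. $J_\beta(\theta_0)$ is positive definite. 5. There are functions $M_{jkl}$ with $\int M_{jkl}f_{\theta_0}\,d\mu<\infty$ such that, for almost all $x$ in the support, $\bigl|\frac{\partial^3}{\partial\theta_j\partial\theta_k\partial\theta_l}V_\theta(x)\bigr|\le M_{jkl}(x)$ for all $\theta\in\omega$ and all $j,k,l$. Assume also that the integrals defining $K_\beta(\theta_0)$ are finite. Put $$Q=J_\beta^{-1}G\,(G^TJ_\beta^{-1}G)^{-1},\qquad P=J_\beta^{-1}-Q\,G^TJ_\beta^{-1},\qquad \Sigma=P K_\beta P,$$ all evaluated at $\theta_0$. Then the restricted minimum density power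 divergence estimator, i.e. the minimizer $\widetilde\theta_n$ of $\frac1n\sum_{i=1}^nV_\theta(X_i)$ subject to $g(\theta)=0$, satisfies $$\sqrt n\,(\widetilde\theta_n-\theta_0)\ \xrightarrow{\ \mathcal L\ }\ \mathcal N(0,\Sigma)$$ in the following sense. (a) There is $\rho_0>0$ such that for every $0<\rho\le\rho_0$: there are measurable functions of $(X_1,\dots,X_n)$ that, with probability tending to one, minimize $\frac1n\sum_{i=1}^n V_\theta(X_i)$ over $\{\theta\in\Theta_0:\|\theta-\theta_0\|\le\rho\}$; and every sequence of random vectors $\widetilde\theta_n$ with this minimizing property satisfies $\widetilde\theta_n\to\theta_0$ in probability and $\sqrt n(\widetilde\theta_n-\theta_0)\to\mathcal N(0,\Sigma)$ in law. (b) Every sequence of random vectors $\widetilde\theta_n$ which, with probability tending to one, belongs to $\Theta_0$ and is a (local or global) minimizer of $\frac1n\sum_{i=1}^nV_\theta(X_i)$ over $\Theta_0$, and which converges to $\theta_0$ in probability, satisfies $\sqrt n(\widetilde\theta_n-\theta_0)\to\mathcal N(0,\Sigma)$ in law. -/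

import Mathlib

open MeasureTheory ProbabilityTheory Filter Topology

noncomputable section

namespace DPD

/-- The parameter vectors live in `ℝᵖ` with its Euclidean structure. -/
abbrev E (p : ℕ) := EuclideanSpace ℝ (Fin p)

/-- The partial derivative `∂F/∂θ_j`, as a function of `θ`. -/
def pd {p : ℕ} (j : Fin p) (F : E p → ℝ) (θ : E p) : ℝ :=
  fderiv ℝ F θ (EuclideanSpace.single j 1)

/-- A sequence of events has probability tending to one (stated through the outer measure of the
complements, so that no measurability of the events is needed). -/
def WithHighProbability {Ω : Type*} [MeasurableSpace Ω] (P : Measure Ω)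
    (A : ℕ → Ω → Prop) : Prop :=
  Tendsto (fun n => P {w | ¬ A n w}) atTop (𝓝 0)

section Model

variable {p : ℕ} {𝒳 : Type*} [MeasurableSpace 𝒳]

/-- The probability measure with density `f_θ` with respect to `μ`. -/
def modelMeasure (μ : Measure 𝒳) (f : E p → 𝒳 → ℝ) (θ : E p) : Measure 𝒳 :=
  μ.withDensity (fun x => ENNReal.ofReal (f θ x))

/-- `(f_θ)`, `θ ∈ Θ`, is an identifiable family of probability densities with respect to `μ`,
with open parameter space `Θ ⊆ ℝᵖ`. -/
structure IsParametricModel (Θ : Set (E p)) (μ : Measure 𝒳) (f : E p → 𝒳 → ℝ) : Prop where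
  isOpen : IsOpen Θ
  measurable : ∀ θ ∈ Θ, Measurable (f θ)
  nonneg : ∀ θ ∈ Θ, ∀ x, 0 ≤ f θ x
  isProbabilityMeasure : ∀ θ ∈ Θ, IsProbabilityMeasure (modelMeasure μ f θ)
  identifiable : Set.InjOn (modelMeasure μ f) Θ

/-- `V_θ(x) = ∫ f_θ^{1+β} dμ - (1 + 1/β) f_θ(x)^β` for `β > 0`, and `-log f_θ(x)` for `β = 0`. -/
def V (μ : Measure 𝒳) (f : E p → 𝒳 → ℝ) (β : ℝ) (θ : E p) (x : 𝒳) : ℝ :=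
  if β = 0 then -Real.log (f θ x)
  else (∫ y, f θ y ^ (1 + β) ∂μ) - (1 + 1 / β) * f θ x ^ β

/-- The empirical objective function `(1/n) ∑ V_θ(xᵢ)`. -/
def objective (μ : Measure 𝒳) (f : E p → 𝒳 → ℝ) (β : ℝ) {n : ℕ} (x : Fin n → 𝒳)
    (θ : E p) : ℝ :=
  (1 / (n : ℝ)) * ∑ i, V μ f β θ (x i)

/-- The `j`-th component of the likelihood score `u_θ(x) = ∂ log f_θ(x) / ∂θ`. -/
def score (f : E p → 𝒳 → ℝ) (θ : E p) (x : 𝒳) (j : Fin p) : ℝ :=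
  pd j (fun t => Real.log (f t x)) θ

/-- `J_β(θ) = ∫ u_θ u_θᵀ f_θ^{1+β} dμ` (the form under the model). -/
def J (μ : Measure 𝒳) (f : E p → 𝒳 → ℝ) (β : ℝ) (θ : E p) : Matrix (Fin p) (Fin p) ℝ :=
  Matrix.of fun i j => ∫ x, score f θ x i * score f θ x j * f θ x ^ (1 + β) ∂μ

/-- `ξ_β(θ) = ∫ u_θ f_θ^{1+β} dμ`. -/
def xi (μ : Measure 𝒳) (f : E p → 𝒳 → ℝ) (β : ℝ) (θ : E p) (i : Fin p) : ℝ :=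
  ∫ x, score f θ x i * f θ x ^ (1 + β) ∂μ

/-- `K_β(θ) = ∫ u_θ u_θᵀ f_θ^{1+2β} dμ - ξ_β(θ) ξ_β(θ)ᵀ`. -/
def K (μ : Measure 𝒳) (f : E p → 𝒳 → ℝ) (β : ℝ) (θ : E p) : Matrix (Fin p) (Fin p) ℝ :=
  Matrix.of fun i j =>
    (∫ x, score f θ x i * score f θ x j * f θ x ^ (1 + 2 * β) ∂μ) - xi μ f β θ i * xi μ f β θ j

/-- The integral `∫ F_θ dμ` exists for `θ` in `s`, is three times differentiable with respect to
`θ` there, and its derivatives up to order three can be taken under the integral sign. -/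
structure ThriceDiffUnderIntegral (μ : Measure 𝒳) (F : E p → 𝒳 → ℝ) (s : Set (E p)) :
    Prop where
  integrable₀ : ∀ θ ∈ s, Integrable (F θ) μ
  integrable₁ : ∀ θ ∈ s, ∀ j, Integrable (fun x => pd j (fun t => F t x) θ) μ
  integrable₂ : ∀ θ ∈ s, ∀ j k, Integrable (fun x => pd j (pd k (fun t => F t x)) θ) μ
  integrable₃ : ∀ θ ∈ s, ∀ j k l,
    Integrable (fun x => pd j (pd k (pd l (fun t => F t x))) θ) μ
  differentiable₁ : DifferentiableOn ℝ (fun t => ∫ x, F t x ∂μ) s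
  differentiable₂ : ∀ l, DifferentiableOn ℝ (pd l (fun t => ∫ x, F t x ∂μ)) s
  differentiable₃ : ∀ k l, DifferentiableOn ℝ (pd k (pd l (fun t => ∫ x, F t x ∂μ))) s
  deriv₁ : ∀ θ ∈ s, ∀ j,
    pd j (fun t => ∫ x, F t x ∂μ) θ = ∫ x, pd j (fun t => F t x) θ ∂μ
  deriv₂ : ∀ θ ∈ s, ∀ j k,
    pd j (pd k (fun t => ∫ x, F t x ∂μ)) θ = ∫ x, pd j (pd k (fun t => F t x)) θ ∂μ
  deriv₃ : ∀ θ ∈ s, ∀ j k l,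
    pd j (pd k (pd l (fun t => ∫ x, F t x ∂μ))) θ
      = ∫ x, pd j (pd k (pd l (fun t => F t x))) θ ∂μ

/-- The consolidated Lehmann and Basu et al. regularity conditions when the true density is
`h = f_{θ₀}`, a member of the model. -/
structure LehmannBasuConditions (Θ : Set (E p)) (μ : Measure 𝒳) (f : E p → 𝒳 → ℝ) (β : ℝ)
    (θ₀ : E p) : Prop where
  /-- The support `{x | f_θ(x) > 0}` does not depend on `θ`. -/
  common_support : ∀ θ ∈ Θ, {x | 0 < f θ x} = {x | 0 < f θ₀ x}
  /-- There is a neighbourhood `s` of `θ₀` on which the remaining smoothness conditions hold. -/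
  smooth : ∃ s : Set (E p), IsOpen s ∧ s ⊆ Θ ∧ θ₀ ∈ s ∧
    (∀ᵐ x ∂μ, 0 < f θ₀ x → ContDiffOn ℝ 3 (fun θ => f θ x) s) ∧
    ThriceDiffUnderIntegral μ (fun θ x => f θ x ^ (1 + β)) s ∧
    ThriceDiffUnderIntegral μ (fun θ x => f θ x ^ β * f θ₀ x) s ∧
    ∃ M : Fin p → Fin p → Fin p → 𝒳 → ℝ,
      (∀ᵐ x ∂μ, 0 < f θ₀ x → ∀ θ ∈ s, ∀ j k l,
        |pd j (pd k (pd l (fun t => V μ f β t x))) θ| ≤ M j k l x) ∧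
      ∀ j k l, Integrable (M j k l) (modelMeasure μ f θ₀)
  posDef : (J μ f β θ₀).PosDef

end Model

section Constraint

variable {p r : ℕ}

/-- The `p × r` matrix `G(θ) = ∂gᵀ(θ)/∂θ`. -/
def G (g : E p → E r) (θ : E p) : Matrix (Fin p) (Fin r) ℝ :=
  Matrix.of fun i j => pd i (fun t => g t j) θ

/-- The restricted parameter space `Θ₀ = {θ ∈ Θ | g(θ) = 0}`. -/
def restricted (Θ : Set (E p)) (g : E p → E r) : Set (E p) := {θ | θ ∈ Θ ∧ g θ = 0}

variable {𝒳 : Type*} [MeasurableSpace 𝒳]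

/-- `Q = J⁻¹ G (Gᵀ J⁻¹ G)⁻¹`. -/
def Q (μ : Measure 𝒳) (f : E p → 𝒳 → ℝ) (β : ℝ) (g : E p → E r) (θ : E p) :
    Matrix (Fin p) (Fin r) ℝ :=
  (J μ f β θ)⁻¹ * G g θ * ((G g θ).transpose * (J μ f β θ)⁻¹ * G g θ)⁻¹

/-- `P = J⁻¹ - Q Gᵀ J⁻¹`. -/
def P (μ : Measure 𝒳) (f : E p → 𝒳 → ℝ) (β : ℝ) (g : E p → E r) (θ : E p) :
    Matrix (Fin p) (Fin p) ℝ :=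
  (J μ f β θ)⁻¹ - Q μ f β g θ * (G g θ).transpose * (J μ f β θ)⁻¹

/-- `Σ = P K P`. -/
def asymptoticCov (μ : Measure 𝒳) (f : E p → 𝒳 → ℝ) (β : ℝ) (g : E p → E r) (θ : E p) :
    Matrix (Fin p) (Fin p) ℝ :=
  P μ f β g θ * K μ f β θ * P μ f β g θ

/-- `√n (θ̃ₙ - θ₀)` converges in law to the centred normal distribution with covariance matrix
`S`. -/
def AsymptoticallyNormal {Ω : Type*} [MeasurableSpace Ω] (Pr : Measure Ω)
    [IsProbabilityMeasure Pr] (est : ℕ → Ω → E p) (θ₀ : E p) (S : Matrix (Fin p) (Fin p) ℝ) :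
    Prop :=
  TendstoInDistribution (fun (n : ℕ) w => √(n : ℝ) • (est n w - θ₀)) atTop
    (id : E p → E p) (fun _ => Pr) (multivariateGaussian 0 S)

end Constraint

end DPD

end

/-! The estimator is treated as a constrained M-estimator. Divided by `1 + β`, the criterion has at
`θ₀` the gradient `ξ - u f^β`, centred with covariance `K_β`, and mean Hessian `J_β`; both facts
come from differentiating under the integral sign (`exists_regularCriterion`). Bounded third
derivatives give each summand a quadratic expansion. By the law of large numbers the average then
expands with a Hessian close to `J_β` and a bounded error constant
(`RegularCriterion.average_approx`).

Since `J_β` is positive definite, a point of a small ball where the average does not exceed its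
value at `θ₀` lies within a multiple of the norm of the averaged gradient, which tends to zero.
Hence minimizers on the ball are consistent (`RegularCriterion.tendstoInMeasure`).

Let `d` be the estimation error and `z` the averaged gradient at `θ₀`. The Lagrange rule reads,
approximately, `z + J d + G λ = 0` with `Gᵀ d = 0`. As `P G = 0` and `P J = 1 - Q Gᵀ`, applying `P`
leaves `d ≈ -P z`. In `exists_norm_add_le_of_stationary` the error is an arbitrarily small multiple
of `‖z‖`, so no separate `√n` rate is needed. The central limit theorem for `-P z` and Slutsky's
lemma give the limit with covariance `P K P`. Measurable minimizers come from compactness and a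
coordinatewise selection (`exists_measurable_isMinOn`). -/

noncomputable section

namespace DPD

/-! ### Events of probability tending to one. -/

section HighProbability

variable {Ω : Type*} [MeasurableSpace Ω] {Pr : Measure Ω}

lemma WithHighProbability.mono {A B : ℕ → Ω → Prop} (hA : WithHighProbability Pr A)
    (h : ∀ n w, A n w → B n w) : WithHighProbability Pr B :=
  tendsto_of_tendsto_of_tendsto_of_le_of_le tendsto_const_nhds hA (fun _ => zero_le)
    fun n => measure_mono fun w hw hB => hw (h n w hB)

lemma WithHighProbability.and {A B : ℕ → Ω → Prop} (hA : WithHighProbability Pr A)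
    (hB : WithHighProbability Pr B) : WithHighProbability Pr fun n w => A n w ∧ B n w := by
  have h := Tendsto.add hA hB
  rw [add_zero] at h
  refine tendsto_of_tendsto_of_tendsto_of_le_of_le tendsto_const_nhds h (fun _ => zero_le)
    fun n => (measure_mono ?_).trans (measure_union_le _ _)
  intro w hw
  by_cases hAw : A n w
  · exact Or.inr fun hBw => hw ⟨hAw, hBw⟩
  · exact Or.inl hAw

lemma WithHighProbability.of_ae {A : ℕ → Ω → Prop} (h : ∀ n, ∀ᵐ w ∂Pr, A n w) :
    WithHighProbability Pr A := by
  have h0 : (fun n => Pr {w | ¬ A n w}) = fun _ => 0 := funext fun n => ae_iff.1 (h n)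
  unfold WithHighProbability
  rw [h0]
  exact tendsto_const_nhds

lemma withHighProbability_of_tendstoInMeasure {F : Type*} [SeminormedAddCommGroup F]
    {Y : ℕ → Ω → F} {y : F} (h : TendstoInMeasure Pr Y atTop fun _ => y) {δ : ℝ} (hδ : 0 < δ) :
    WithHighProbability Pr fun n w => ‖Y n w - y‖ < δ := by
  have h' := (tendstoInMeasure_iff_norm.1 h) δ hδ
  simpa [WithHighProbability, not_lt] using h'

lemma tendstoInMeasure_of_withHighProbability {F : Type*} [SeminormedAddCommGroup F]
    {Y : ℕ → Ω → F} {y : F}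
    (h : ∀ δ > 0, WithHighProbability Pr fun n w => ‖Y n w - y‖ < δ) :
    TendstoInMeasure Pr Y atTop fun _ => y := by
  refine tendstoInMeasure_iff_norm.2 fun δ hδ => ?_
  simpa [WithHighProbability, not_lt] using h δ hδ

end HighProbability

/-! ### Limit theorems for i.i.d. samples. -/

section IID

variable {Ω 𝒳 : Type*} [MeasurableSpace Ω] [MeasurableSpace 𝒳] {Pr : Measure Ω}
  [IsProbabilityMeasure Pr] {ν : Measure 𝒳} {X : ℕ → Ω → 𝒳}

/-- The law of large numbers, as a statement about high probability. -/
lemma withHighProbability_mean {F : Type*} [NormedAddCommGroup F] [NormedSpace ℝ F]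
    [CompleteSpace F] [MeasurableSpace F] [BorelSpace F]
    (hX : ∀ i, Measurable (X i)) (hindep : iIndepFun X Pr) (hlaw : ∀ i, Pr.map (X i) = ν)
    {φ : 𝒳 → F} (hφ : Integrable φ ν) {δ : ℝ} (hδ : 0 < δ) :
    WithHighProbability Pr fun n w =>
      ‖(n : ℝ)⁻¹ • ∑ i ∈ Finset.range n, φ (X i w) - ∫ x, φ x ∂ν‖ < δ := by
  have hφX : ∀ i, AEMeasurable φ (Pr.map (X i)) := fun i => by
    rw [hlaw i]; exact hφ.aestronglyMeasurable.aemeasurable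
  have hsm : ∀ i, AEStronglyMeasurable (fun w => φ (X i w)) Pr := fun i =>
    AEStronglyMeasurable.comp_measurable (by rw [hlaw i]; exact hφ.aestronglyMeasurable) (hX i)
  have hint : Integrable (φ ∘ X 0) Pr :=
    Integrable.comp_measurable (by rw [hlaw 0]; exact hφ) (hX 0)
  have hind : iIndepFun (fun i => φ ∘ X i) Pr :=
    hindep.comp₀ (fun _ => φ) (fun i => (hX i).aemeasurable) hφX
  have hid : ∀ i, IdentDistrib (φ ∘ X i) (φ ∘ X 0) Pr Pr := fun i =>
    IdentDistrib.comp_of_aemeasurable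
      ⟨(hX i).aemeasurable, (hX 0).aemeasurable, by rw [hlaw i, hlaw 0]⟩ (hφX i)
  have hae := strong_law_ae (fun i => φ ∘ X i) hint (fun i j hij => hind.indepFun hij) hid
  have hmean : ∫ w, (φ ∘ X 0) w ∂Pr = ∫ x, φ x ∂ν := by
    rw [← hlaw 0, integral_map (hX 0).aemeasurable (by rw [hlaw 0]; exact hφ.aestronglyMeasurable)]
    rfl
  rw [hmean] at hae
  refine withHighProbability_of_tendstoInMeasure (tendstoInMeasure_of_tendsto_ae ?_ hae) hδ
  intro n
  exact (Finset.aestronglyMeasurable_fun_sum _ fun i _ => hsm i).const_smul _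

variable {p : ℕ}

/-- The quadratic form of `S` at `t` is the second moment of `⟨t, φ⟩`. It serves as the variance in
the scalar central limit theorem, and its nonnegativity makes the Gaussian law with covariance `S`
have the expected characteristic function. -/
lemma posSemidef_of_second_moments {φ : 𝒳 → E p} (hφ : MemLp φ 2 ν)
    {S : Matrix (Fin p) (Fin p) ℝ} (hS : ∀ i j, ∫ x, φ x i * φ x j ∂ν = S i j) :
    (∀ t : E p, t.ofLp ⬝ᵥ S.mulVec t.ofLp = ∫ x, inner ℝ t (φ x) ^ 2 ∂ν) ∧ S.PosSemidef := by
  have hc : ∀ i, MemLp (fun x => φ x i) 2 ν := fun i => hφ.eval_piLp i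
  have hquad : ∀ t : E p, t.ofLp ⬝ᵥ S.mulVec t.ofLp = ∫ x, inner ℝ t (φ x) ^ 2 ∂ν := by
    intro t
    have h1 : ∀ x, inner ℝ t (φ x) ^ 2 = ∑ i, ∑ j, t i * t j * (φ x i * φ x j) := by
      intro x
      rw [PiLp.inner_apply, sq, Finset.sum_mul_sum]
      simp only [RCLike.inner_apply, conj_trivial]
      exact Finset.sum_congr rfl fun i _ => Finset.sum_congr rfl fun j _ => by ring
    have hi : ∀ i j, Integrable (fun x => t i * t j * (φ x i * φ x j)) ν := fun i j =>
      ((hc i).integrable_mul (hc j)).const_mul _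
    simp_rw [h1]
    rw [integral_finsetSum _ fun i _ => integrable_finsetSum _ fun j _ => hi i j]
    simp_rw [integral_finsetSum _ fun j (_ : j ∈ Finset.univ) => hi _ j, integral_const_mul, hS]
    simp only [dotProduct, Matrix.mulVec, Finset.mul_sum]
    exact Finset.sum_congr rfl fun i _ => Finset.sum_congr rfl fun j _ => by ring
  refine ⟨hquad, Matrix.PosSemidef.of_dotProduct_mulVec_nonneg ?_ fun t => ?_⟩
  · ext i j
    simp only [Matrix.conjTranspose_apply, star_trivial, ← hS]
    simp_rw [mul_comm]
  · have h := hquad (WithLp.toLp 2 t)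
    simp only [star_trivial]
    rw [show t ⬝ᵥ S.mulVec t = _ from h]
    exact integral_nonneg fun x => sq_nonneg _

/-- The multivariate central limit theorem. -/
lemma tendstoInDistribution_multivariate
    (hX : ∀ i, Measurable (X i)) (hindep : iIndepFun X Pr) (hlaw : ∀ i, Pr.map (X i) = ν)
    {φ : 𝒳 → E p} (hφ : MemLp φ 2 ν) (hmean : ∀ j, ∫ x, φ x j ∂ν = 0)
    {S : Matrix (Fin p) (Fin p) ℝ} (hS : ∀ i j, ∫ x, φ x i * φ x j ∂ν = S i j) :
    TendstoInDistribution (fun (n : ℕ) w => (√(n : ℝ))⁻¹ • ∑ i ∈ Finset.range n, φ (X i w)) atTop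
      (id : E p → E p) (fun _ => Pr) (multivariateGaussian 0 S) := by
  have hν : IsProbabilityMeasure ν := by
    rw [← hlaw 0]; exact Measure.isProbabilityMeasure_map (hX 0).aemeasurable
  obtain ⟨hquad, hpsd⟩ := posSemidef_of_second_moments hφ hS
  have hmeas : ∀ i, AEMeasurable (fun w => φ (X i w)) Pr := fun i =>
    AEMeasurable.comp_measurable (by rw [hlaw i]; exact hφ.aestronglyMeasurable.aemeasurable) (hX i)
  have hW : ∀ n : ℕ, AEMeasurable
      (fun w => (√(n : ℝ))⁻¹ • ∑ i ∈ Finset.range n, φ (X i w)) Pr := fun n =>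
    (Finset.aemeasurable_fun_sum (Finset.range n) fun i _ => hmeas i).const_smul (√(n : ℝ))⁻¹
  -- Cramér–Wold: the characteristic function of the vector sum at `t` is that of the scalar sum of
  -- `⟨t, φ⟩` at `1`, so the one-dimensional theorem suffices.
  refine ⟨hW, by fun_prop, ProbabilityMeasure.tendsto_iff_tendsto_charFun.2 fun t => ?_⟩
  have hi : MemLp (fun x => inner ℝ t (φ x)) 2 ν := hφ.const_inner t
  have hφX : ∀ i, AEMeasurable (fun x => inner ℝ t (φ x)) (Pr.map (X i)) := fun i => by
    rw [hlaw i]; exact hi.aestronglyMeasurable.aemeasurable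
  have hind : iIndepFun (fun i => (fun x => inner ℝ t (φ x)) ∘ X i) Pr :=
    hindep.comp₀ (fun _ x => inner ℝ t (φ x)) (fun i => (hX i).aemeasurable) hφX
  have hid : ∀ i, IdentDistrib ((fun x => inner ℝ t (φ x)) ∘ X i)
      ((fun x => inner ℝ t (φ x)) ∘ X 0) Pr Pr := fun i =>
    IdentDistrib.comp_of_aemeasurable
      ⟨(hX i).aemeasurable, (hX 0).aemeasurable, by rw [hlaw i, hlaw 0]⟩ (hφX i)
  have hmem : MemLp ((fun x => inner ℝ t (φ x)) ∘ X 0) 2 Pr :=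
    MemLp.comp_of_map (by rw [hlaw 0]; exact hi) (hX 0).aemeasurable
  have hE : ∫ w, ((fun x => inner ℝ t (φ x)) ∘ X 0) w ∂Pr = 0 := by
    have h1 : ∫ w, ((fun x => inner ℝ t (φ x)) ∘ X 0) w ∂Pr = ∫ x, inner ℝ t (φ x) ∂ν := by
      rw [← hlaw 0, integral_map (hX 0).aemeasurable (hφX 0).aestronglyMeasurable]
      rfl
    rw [h1]
    simp only [PiLp.inner_apply, RCLike.inner_apply, conj_trivial]
    rw [integral_finsetSum _ fun i _ =>
      ((hφ.eval_piLp i).integrable (by norm_num)).mul_const _]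
    simp [integral_mul_const, hmean]
  have hVar : Var[(fun x => inner ℝ t (φ x)) ∘ X 0; Pr] = t.ofLp ⬝ᵥ S.mulVec t.ofLp := by
    rw [variance_eq_integral hmem.aestronglyMeasurable.aemeasurable, hE, hquad, ← hlaw 0,
      integral_map (hX 0).aemeasurable ((hφX 0).pow_const 2).aestronglyMeasurable]
    simp
  have hclt := tendstoInDistribution_inv_sqrt_mul_sum_sub (Y := id)
    (P' := gaussianReal 0 Var[(fun x => inner ℝ t (φ x)) ∘ X 0; Pr].toNNReal) ⟨by fun_prop, by simp⟩
    hmem hind hid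
  have h1 := ProbabilityMeasure.tendsto_iff_tendsto_charFun.1 hclt.tendsto 1
  have hlim : charFun (Measure.map (id : ℝ → ℝ)
      (gaussianReal 0 Var[(fun x => inner ℝ t (φ x)) ∘ X 0; Pr].toNNReal)) 1 =
      charFun (Measure.map (id : E p → E p) (multivariateGaussian 0 S)) t := by
    rw [Measure.map_id, Measure.map_id, charFun_gaussianReal, charFun_multivariateGaussian hpsd,
      Real.coe_toNNReal _ (variance_nonneg _ _), hVar]
    simp
  simp only [ProbabilityMeasure.coe_mk] at h1 ⊢
  rw [hlim] at h1
  refine h1.congr fun n => ?_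
  rw [charFun_apply, charFun_apply, integral_map (hclt.forall_aemeasurable n) (by fun_prop),
    integral_map (hW n) (by fun_prop)]
  refine integral_congr_ae (ae_of_all _ fun w => ?_)
  dsimp only
  rw [hE, mul_zero, sub_zero]
  congr 3
  rw [real_inner_comm t, inner_smul_right, inner_sum]
  simp

/-- Pointwise convergence of characteristic functions to one continuous at zero gives tightness. The
bound is uniform in `n`; it later turns a small multiple of the averaged gradient into a negligible
term. -/
lemma exists_norm_bound_of_tendstoInDistribution {W : ℕ → Ω → E p} {γ : Measure (E p)}
    [IsProbabilityMeasure γ] (h : TendstoInDistribution W atTop (id : E p → E p) (fun _ => Pr) γ)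
    {ε : ENNReal} (hε : 0 < ε) : ∃ a : ℝ, ∀ n, Pr {w | a < ‖W n w‖} ≤ ε := by
  have hp : ∀ n, IsProbabilityMeasure (Pr.map (W n)) := fun n =>
    Measure.isProbabilityMeasure_map (h.forall_aemeasurable n)
  have ht := isTightMeasureSet_of_tendsto_charFun (μ := fun n => Pr.map (W n))
    (f := charFun (Measure.map (id : E p → E p) γ)) (by
      rw [Measure.map_id]; exact continuous_charFun.continuousAt)
    (ProbabilityMeasure.tendsto_iff_tendsto_charFun.1 h.tendsto)
  have h2 := tendsto_measure_norm_gt_of_isTightMeasureSet ht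
  obtain ⟨a, ha⟩ := (h2.eventually_le_const hε).exists
  refine ⟨a, fun n => ?_⟩
  have h3 : Pr.map (W n) {x | a < ‖x‖} ≤ ε :=
    (le_iSup₂ (f := fun (μ : Measure (E p)) (_ : μ ∈ Set.range fun n => Pr.map (W n)) =>
      μ {x | a < ‖x‖}) (Pr.map (W n)) ⟨n, rfl⟩).trans ha
  rwa [Measure.map_apply_of_aemeasurable (h.forall_aemeasurable n)
    (measurableSet_lt measurable_const measurable_norm)] at h3

end IID

/-! ### Quadratic approximation from bounded third derivatives. -/

section Gradient

variable {p : ℕ}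

/-- The vector of partial derivatives. -/
def grad (v : E p → ℝ) (θ : E p) : E p := WithLp.toLp 2 fun j => pd j v θ

lemma sum_smul_single (w : E p) : ∑ j, w j • (EuclideanSpace.single j (1 : ℝ) : E p) = w := by
  ext i
  simp [Pi.single_apply]

lemma fderiv_apply_eq_sum (v : E p → ℝ) (θ w : E p) :
    fderiv ℝ v θ w = ∑ j, w j * pd j v θ := by
  conv_lhs => rw [← sum_smul_single w]
  simp [pd]

lemma fderiv_apply_eq_inner (v : E p → ℝ) (θ w : E p) :
    fderiv ℝ v θ w = inner ℝ (grad v θ) w := by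
  rw [fderiv_apply_eq_sum, PiLp.inner_apply]
  simp [grad]

lemma norm_le_sum_abs (w : E p) : ‖w‖ ≤ ∑ j, |w j| := by
  conv_lhs => rw [← sum_smul_single w]
  refine (norm_sum_le _ _).trans (Finset.sum_le_sum fun j _ => ?_)
  simp [norm_smul]

/-- On the ball of radius `ρ` around `θ₀` the function `v` is continuously differentiable and is
approximated, together with its gradient, by the quadratic polynomial with gradient `z` and
Hessian `H` at `θ₀`; `b` bounds the error. -/
structure QuadApprox (v : E p → ℝ) (θ₀ : E p) (ρ : ℝ) (z : E p) (H : E p →L[ℝ] E p) (b : ℝ) :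
    Prop where
  contDiffOn : ContDiffOn ℝ 1 v (Metric.ball θ₀ ρ)
  grad_le : ∀ θ ∈ Metric.ball θ₀ ρ, ‖grad v θ - z - H (θ - θ₀)‖ ≤ b * ‖θ - θ₀‖ ^ 2
  val_le : ∀ θ ∈ Metric.ball θ₀ ρ,
    |v θ - v θ₀ - inner ℝ z (θ - θ₀) - 1 / 2 * inner ℝ (H (θ - θ₀)) (θ - θ₀)|
      ≤ b * ‖θ - θ₀‖ ^ 3

lemma QuadApprox.differentiableAt {v : E p → ℝ} {θ₀ : E p} {ρ : ℝ} {z : E p}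
    {H : E p →L[ℝ] E p} {b : ℝ} (h : QuadApprox v θ₀ ρ z H b) {θ : E p}
    (hθ : θ ∈ Metric.ball θ₀ ρ) : DifferentiableAt ℝ v θ :=
  (h.contDiffOn.contDiffAt (Metric.isOpen_ball.mem_nhds hθ)).differentiableAt (by norm_num)

lemma grad_sum {ι : Type*} {s : Finset ι} {v : ι → E p → ℝ} {θ : E p}
    (h : ∀ i ∈ s, DifferentiableAt ℝ (v i) θ) :
    grad (fun t => ∑ i ∈ s, v i t) θ = ∑ i ∈ s, grad (v i) θ := by
  ext j
  simp [grad, pd, fderiv_fun_sum h]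

lemma grad_const_mul {v : E p → ℝ} {θ : E p} (h : DifferentiableAt ℝ v θ) (c : ℝ) :
    grad (fun t => c * v t) θ = c • grad v θ := by
  ext j
  simp [grad, pd, fderiv_const_mul h]

lemma QuadApprox.sum {ι : Type*} {s : Finset ι} {v : ι → E p → ℝ} {θ₀ : E p} {ρ : ℝ}
    {z : ι → E p} {H : ι → E p →L[ℝ] E p} {b : ι → ℝ}
    (h : ∀ i ∈ s, QuadApprox (v i) θ₀ ρ (z i) (H i) (b i)) :
    QuadApprox (fun t => ∑ i ∈ s, v i t) θ₀ ρ (∑ i ∈ s, z i) (∑ i ∈ s, H i) (∑ i ∈ s, b i) where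
  contDiffOn := ContDiffOn.sum fun i hi => (h i hi).contDiffOn
  grad_le θ hθ := by
    rw [grad_sum fun i hi => (h i hi).differentiableAt hθ, _root_.sum_apply,
      ← Finset.sum_sub_distrib, ← Finset.sum_sub_distrib, Finset.sum_mul]
    exact (norm_sum_le _ _).trans (Finset.sum_le_sum fun i hi => (h i hi).grad_le θ hθ)
  val_le θ hθ := by
    rw [_root_.sum_apply, sum_inner, sum_inner, Finset.mul_sum,
      ← Finset.sum_sub_distrib, ← Finset.sum_sub_distrib, ← Finset.sum_sub_distrib,
      Finset.sum_mul]
    exact (Finset.abs_sum_le_sum_abs _ _).trans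
      (Finset.sum_le_sum fun i hi => (h i hi).val_le θ hθ)

lemma QuadApprox.const_mul {v : E p → ℝ} {θ₀ : E p} {ρ : ℝ} {z : E p} {H : E p →L[ℝ] E p}
    {b : ℝ} (h : QuadApprox v θ₀ ρ z H b) {c : ℝ} (hc : 0 ≤ c) :
    QuadApprox (fun t => c * v t) θ₀ ρ (c • z) (c • H) (c • b) where
  contDiffOn := contDiffOn_const.mul h.contDiffOn
  grad_le θ hθ := by
    rw [grad_const_mul (h.differentiableAt hθ), _root_.smul_apply, ← smul_sub,
      ← smul_sub, norm_smul, Real.norm_of_nonneg hc, smul_eq_mul, mul_assoc]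
    exact mul_le_mul_of_nonneg_left (h.grad_le θ hθ) hc
  val_le θ hθ := by
    rw [_root_.smul_apply, real_inner_smul_left, real_inner_smul_left, smul_eq_mul,
      mul_assoc c b]
    refine le_trans (le_of_eq ?_) (mul_le_mul_of_nonneg_left (h.val_le θ hθ) hc)
    rw [← abs_of_nonneg hc, ← abs_mul, abs_of_nonneg hc]
    congr 1
    ring

/-- A bound on the error of an affine approximation of the gradient integrates to a bound on the
error of the quadratic approximation of the function. -/
lemma abs_sub_quadratic_le {v : E p → ℝ} {θ₀ : E p} {ρ : ℝ}
    (hv : DifferentiableOn ℝ v (Metric.ball θ₀ ρ)) {z : E p} {H : E p →L[ℝ] E p} {c : ℝ} {m : ℕ}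
    (hc : 0 ≤ c)
    (h : ∀ θ ∈ Metric.ball θ₀ ρ, ‖grad v θ - z - H (θ - θ₀)‖ ≤ c * ‖θ - θ₀‖ ^ m)
    {θ : E p} (hθ : θ ∈ Metric.ball θ₀ ρ) :
    |v θ - v θ₀ - inner ℝ z (θ - θ₀) - 1 / 2 * inner ℝ (H (θ - θ₀)) (θ - θ₀)|
      ≤ c * ‖θ - θ₀‖ ^ (m + 1) := by
  set d := θ - θ₀ with hd
  have hmem : ∀ t ∈ Set.Icc (0 : ℝ) 1, θ₀ + t • d ∈ Metric.ball θ₀ ρ := by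
    intro t ht
    rw [mem_ball_iff_norm, add_sub_cancel_left, norm_smul, Real.norm_of_nonneg ht.1]
    exact (mul_le_of_le_one_left (norm_nonneg _) ht.2).trans_lt (mem_ball_iff_norm.1 hθ)
  -- Along the segment the remainder has derivative `⟨gradient error, d⟩`, at most `c * ‖d‖ ^ (m +
  -- 1)` because `t ≤ 1`. The mean value inequality then suffices; the factor `1 / (m + 1)` is given
  -- away.
  have hderiv : ∀ t ∈ Set.Icc (0 : ℝ) 1, HasDerivWithinAt
      (fun t : ℝ => v (θ₀ + t • d) - t * inner ℝ z d - t ^ 2 / 2 * inner ℝ (H d) d)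
      (inner ℝ (grad v (θ₀ + t • d) - z - H (t • d)) d) (Set.Icc 0 1) t := by
    intro t ht
    have h1 : HasDerivAt (fun t : ℝ => θ₀ + t • d) d t := by
      simpa using ((hasDerivAt_id t).smul_const d).const_add θ₀
    have h2 : HasDerivAt (fun t : ℝ => v (θ₀ + t • d)) (fderiv ℝ v (θ₀ + t • d) d) t :=
      ((hv.differentiableAt (Metric.isOpen_ball.mem_nhds (hmem t ht))).hasFDerivAt).comp_hasDerivAt
        t h1
    have h3 : HasDerivAt (fun t : ℝ => t * inner ℝ z d) (inner ℝ z d) t := by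
      simpa using (hasDerivAt_id t).mul_const (inner ℝ z d)
    have h4 : HasDerivAt (fun t : ℝ => t ^ 2 / 2 * inner ℝ (H d) d) (t * inner ℝ (H d) d) t := by
      have := (((hasDerivAt_id t).pow 2).div_const 2).mul_const (inner ℝ (H d) d)
      convert! this using 1
      simp
    convert! ((h2.sub h3).sub h4).hasDerivWithinAt using 1
    rw [fderiv_apply_eq_inner, inner_sub_left, inner_sub_left, map_smul, real_inner_smul_left]
  have hbound : ∀ t ∈ Set.Ico (0 : ℝ) 1,
      ‖inner ℝ (grad v (θ₀ + t • d) - z - H (t • d)) d‖ ≤ c * ‖d‖ ^ (m + 1) := by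
    intro t ht
    have ht' : t ∈ Set.Icc (0 : ℝ) 1 := ⟨ht.1, ht.2.le⟩
    have h1 := h _ (hmem t ht')
    rw [add_sub_cancel_left] at h1
    refine (norm_inner_le_norm _ _).trans ?_
    rw [pow_succ, ← mul_assoc]
    refine mul_le_mul_of_nonneg_right (h1.trans ?_) (norm_nonneg _)
    refine mul_le_mul_of_nonneg_left (pow_le_pow_left₀ (norm_nonneg _) ?_ m) hc
    rw [norm_smul, Real.norm_of_nonneg ht.1]
    exact mul_le_of_le_one_left (norm_nonneg _) ht.2.le
  have h5 := norm_image_sub_le_of_norm_deriv_le_segment_01' hderiv hbound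
  refine le_trans (le_of_eq ?_) h5
  rw [Real.norm_eq_abs]
  congr 1
  simp [hd]
  ring

/-- Bounded third partial derivatives give a quadratic approximation. -/
lemma quadApprox_of_third_derivative_bound {v : E p → ℝ} {θ₀ : E p} {ρ : ℝ} (hρ : 0 < ρ)
    (h₀ : DifferentiableOn ℝ v (Metric.ball θ₀ ρ))
    (h₁ : ∀ l, DifferentiableOn ℝ (pd l v) (Metric.ball θ₀ ρ))
    (h₂ : ∀ k l, DifferentiableOn ℝ (pd k (pd l v)) (Metric.ball θ₀ ρ))
    {B : Fin p → Fin p → Fin p → ℝ}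
    (h₃ : ∀ θ ∈ Metric.ball θ₀ ρ, ∀ j k l, |pd j (pd k (pd l v)) θ| ≤ B j k l) :
    QuadApprox v θ₀ ρ (grad v θ₀)
      (Matrix.toEuclideanCLM (𝕜 := ℝ) (Matrix.of fun l k => pd k (pd l v) θ₀))
      (∑ l, ∑ k, ∑ j, B j k l) := by
  have hB : ∀ j k l, 0 ≤ B j k l := fun j k l =>
    (abs_nonneg _).trans (h₃ θ₀ (Metric.mem_ball_self hρ) j k l)
  have hS1 : ∀ k l, 0 ≤ ∑ j, B j k l := fun k l => Finset.sum_nonneg fun j _ => hB j k l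
  have hS2 : ∀ l, 0 ≤ ∑ k, ∑ j, B j k l := fun l => Finset.sum_nonneg fun k _ => hS1 k l
  -- The third-order bound is integrated one order at a time by `abs_sub_quadratic_le`: second
  -- derivatives with `m = 0`, first derivatives with `m = 1`, and finally the function itself with
  -- `m = 2`.
  have e1 : ∀ k l, ∀ θ ∈ Metric.ball θ₀ ρ,
      |pd k (pd l v) θ - pd k (pd l v) θ₀| ≤ (∑ j, B j k l) * ‖θ - θ₀‖ := by
    intro k l θ hθ
    have := abs_sub_quadratic_le (h₂ k l) (z := 0) (H := 0) (m := 0) (hS1 k l) (fun t ht => by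
      simpa using (norm_le_sum_abs _).trans (Finset.sum_le_sum fun j _ => h₃ t ht j k l)) hθ
    simpa using this
  have e2 : ∀ l, ∀ θ ∈ Metric.ball θ₀ ρ,
      |pd l v θ - pd l v θ₀ - inner ℝ (grad (pd l v) θ₀) (θ - θ₀)|
        ≤ (∑ k, ∑ j, B j k l) * ‖θ - θ₀‖ ^ 2 := by
    intro l θ hθ
    have := abs_sub_quadratic_le (h₁ l) (z := grad (pd l v) θ₀) (H := 0) (m := 1) (hS2 l)
      (fun t ht => by
        refine (norm_le_sum_abs _).trans ?_
        rw [pow_one, Finset.sum_mul]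
        exact Finset.sum_le_sum fun k _ => by simpa [grad] using e1 k l t ht) hθ
    simpa using this
  have e3 : ∀ θ ∈ Metric.ball θ₀ ρ, ‖grad v θ - grad v θ₀ -
      Matrix.toEuclideanCLM (𝕜 := ℝ) (Matrix.of fun l k => pd k (pd l v) θ₀) (θ - θ₀)‖
        ≤ (∑ l, ∑ k, ∑ j, B j k l) * ‖θ - θ₀‖ ^ 2 := by
    intro θ hθ
    refine (norm_le_sum_abs _).trans ?_
    rw [Finset.sum_mul]
    refine Finset.sum_le_sum fun l _ => le_trans (le_of_eq ?_) (e2 l θ hθ)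
    congr 1
    simp [grad, PiLp.inner_apply, Matrix.mulVec, dotProduct, mul_comm, mul_sub,
      Finset.sum_sub_distrib]
  refine ⟨?_, e3, fun θ hθ => abs_sub_quadratic_le h₀ (Finset.sum_nonneg fun l _ => hS2 l) e3 hθ⟩
  -- The derivative is a combination of the partial derivatives, which are differentiable and hence
  -- continuous.
  rw [show (1 : WithTop ℕ∞) = 0 + 1 by norm_num,
    contDiffOn_succ_iff_fderiv_of_isOpen Metric.isOpen_ball]
  refine ⟨h₀, by simp, contDiffOn_zero.2 ?_⟩
  have : fderiv ℝ v = fun θ => ∑ j, pd j v θ • (EuclideanSpace.proj j : E p →L[ℝ] ℝ) := by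
    funext θ
    ext w
    rw [fderiv_apply_eq_sum]
    simp [mul_comm]
  rw [this]
  exact continuousOn_finsetSum _ fun j _ => (h₁ j).continuousOn.smul continuousOn_const

/-- Quadratic growth: an approximate Hessian that is bounded below controls every point at which
the function does not exceed its value at the centre. -/
lemma QuadApprox.norm_sub_le {v : E p → ℝ} {θ₀ : E p} {ρ : ℝ} {z : E p} {H J : E p →L[ℝ] E p}
    {b c : ℝ} (h : QuadApprox v θ₀ ρ z H b) (hJ : ∀ d, 4 * c * ‖d‖ ^ 2 ≤ inner ℝ (J d) d)
    (hHJ : ‖H - J‖ ≤ c) {θ : E p} (hθ : θ ∈ Metric.ball θ₀ ρ)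
    (hb : b * ‖θ - θ₀‖ ≤ c / 2) (hmin : v θ ≤ v θ₀) : c * ‖θ - θ₀‖ ≤ ‖z‖ := by
  set d := θ - θ₀
  have h1 := (abs_le.1 (h.val_le θ hθ)).1
  have h2 : -(‖z‖ * ‖d‖) ≤ inner ℝ z d := (abs_le.1 (abs_real_inner_le_norm z d)).1
  have h3 : -(c * ‖d‖ * ‖d‖) ≤ inner ℝ ((H - J) d) d :=
    (neg_le_neg (mul_le_mul_of_nonneg_right (((H - J).le_opNorm d).trans
      (mul_le_mul_of_nonneg_right hHJ (norm_nonneg _))) (norm_nonneg _))).trans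
      (abs_le.1 (abs_real_inner_le_norm _ d)).1
  rw [_root_.sub_apply, inner_sub_left] at h3
  have h4 := hJ d
  have h5 : b * ‖d‖ ^ 3 ≤ c / 2 * ‖d‖ ^ 2 := by
    have := mul_le_mul_of_nonneg_right hb (sq_nonneg ‖d‖)
    nlinarith
  rcases (norm_nonneg d).eq_or_lt with h0 | h0
  · rw [← h0]; simp
  -- In units of `‖d‖ ^ 2`: half the form of `J` contributes `2c`, half the Hessian error costs `c /
  -- 2` and the cubic remainder `c / 2`, leaving `c`.
  · have h6 : c * ‖d‖ * ‖d‖ ≤ ‖z‖ * ‖d‖ := by nlinarith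
    exact le_of_mul_le_mul_right h6 h0

end Gradient

/-! ### Perturbation of the Lagrange system. -/

section Stationary

variable {V W : Type*} [NormedAddCommGroup V] [InnerProductSpace ℝ V]
  [NormedAddCommGroup W] [InnerProductSpace ℝ W] [FiniteDimensional ℝ W]

/-- The perturbed Lagrange system: a displacement `d` whose gradient `γ ≈ z + J d` is annihilated
by the kernel of a linear map close to `A`, and which nearly lies in the kernel of `A`, is close to
`-P z`. -/
lemma exists_norm_add_le_of_stationary {A : V →L[ℝ] W} {J P : V →L[ℝ] V} {R : W →L[ℝ] V}
    (hP : ∀ x y, inner ℝ (P x) y = inner ℝ x (P y)) (hPJ : ∀ x, P (J x) = x - R (A x))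
    (hAR : ∀ y, A (R y) = y) (hAP : ∀ x, A (P x) = 0) {ε : ℝ} (hε : 0 < ε) :
    ∃ δ > 0, ∀ (d z γ : V) (A' : V →L[ℝ] W), ‖γ - z - J d‖ ≤ δ * ‖d‖ → ‖A' - A‖ ≤ δ →
      ‖A d‖ ≤ δ * ‖d‖ →
      (∃ (Λ : Module.Dual ℝ W) (Λ₀ : ℝ), (Λ, Λ₀) ≠ 0 ∧
        ∀ x, Λ (A' x) + Λ₀ * inner ℝ γ x = 0) →
      ‖d + P z‖ ≤ ε * ‖z‖ := by
  set a := ‖P‖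
  set r := ‖R‖
  set j := ‖J‖
  have ha : 0 ≤ a := norm_nonneg _
  have hr : 0 ≤ r := norm_nonneg _
  have hj : 0 ≤ j := norm_nonneg _
  -- `C` collects the coefficients of the three terms in `hmain`, with `1` added for positivity. The
  -- four bounds on `δ` control `j + δ`, absorb the multiplier into its own estimate, absorb `‖d‖`
  -- into its own estimate, and give the final `ε`.
  set C := 2 * a * r * (j + 2) + r + a + 1 with hC
  have hC0 : 0 < C := by positivity
  refine ⟨min (min 1 (1 / (2 * (r + 1)))) (min (1 / (2 * C)) (ε / (C * (2 * a + 2)))),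
    by positivity, ?_⟩
  set δ := min (min 1 (1 / (2 * (r + 1)))) (min (1 / (2 * C)) (ε / (C * (2 * a + 2)))) with hδdef
  have hδ0 : 0 < δ := by positivity
  have hδ1 : δ ≤ 1 := (min_le_left _ _).trans (min_le_left _ _)
  have hδr : δ * r ≤ 1 / 2 := by
    have h1 : δ ≤ 1 / (2 * (r + 1)) := (min_le_left _ _).trans (min_le_right _ _)
    rw [le_div_iff₀ (by positivity)] at h1
    nlinarith
  have hδC : δ * C ≤ 1 / 2 := by
    have h1 : δ ≤ 1 / (2 * C) := (min_le_right _ _).trans (min_le_left _ _)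
    rw [le_div_iff₀ (by positivity)] at h1
    linarith
  have hδε : δ * C * (2 * a + 2) ≤ ε := by
    have h1 : δ ≤ ε / (C * (2 * a + 2)) := (min_le_right _ _).trans (min_le_right _ _)
    rw [le_div_iff₀ (by positivity)] at h1
    linarith
  clear_value δ
  rintro d z γ A' hγ hA hAd ⟨Λ, Λ₀, hne, hΛ⟩
  set L : W →L[ℝ] ℝ := LinearMap.toContinuousLinearMap Λ with hL
  have hLΛ : ∀ y, L y = Λ y := fun y => rfl
  have hdiff : ∀ x, ‖(A' - A) x‖ ≤ δ * ‖x‖ := fun x =>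
    ((A' - A).le_opNorm x).trans (mul_le_mul_of_nonneg_right hA (norm_nonneg _))
  -- Stationarity is tested on `R y`. Since `A R = 1`, this expresses `L y` through `γ` and a term
  -- in `A' - A`, which is absorbed because `δ * r ≤ 1 / 2`.
  have hLnorm : ‖L‖ ≤ 2 * r * (|Λ₀| * ‖γ‖) := by
    have h1 : ‖L‖ ≤ |Λ₀| * ‖γ‖ * r + ‖L‖ * (δ * r) := by
      refine L.opNorm_le_bound (by positivity) fun y => ?_
      have h2 : L y = -(Λ₀ * inner ℝ γ (R y)) - L ((A' - A) (R y)) := by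
        have := hΛ (R y)
        rw [_root_.sub_apply, map_sub, hAR, hLΛ (A' (R y))]
        linarith
      have hRy : ‖R y‖ ≤ r * ‖y‖ := R.le_opNorm y
      have h3 : ‖Λ₀ * inner ℝ γ (R y)‖ ≤ |Λ₀| * ‖γ‖ * (r * ‖y‖) := by
        rw [norm_mul, Real.norm_eq_abs, mul_assoc]
        exact mul_le_mul_of_nonneg_left ((norm_inner_le_norm _ _).trans
          (mul_le_mul_of_nonneg_left hRy (norm_nonneg _))) (abs_nonneg _)
      have h4 : ‖L ((A' - A) (R y))‖ ≤ ‖L‖ * (δ * (r * ‖y‖)) :=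
        (L.le_opNorm _).trans (mul_le_mul_of_nonneg_left ((hdiff _).trans
          (mul_le_mul_of_nonneg_left hRy hδ0.le)) (norm_nonneg _))
      rw [h2]
      refine (norm_sub_le _ _).trans ?_
      rw [norm_neg]
      calc _ ≤ |Λ₀| * ‖γ‖ * (r * ‖y‖) + ‖L‖ * (δ * (r * ‖y‖)) := add_le_add h3 h4
        _ = _ := by ring
    have := mul_le_mul_of_nonneg_left hδr (norm_nonneg L)
    linarith
  -- An abnormal multiplier is impossible: with `Λ₀ = 0` the previous bound forces `L = 0` as well.
  have hΛ₀ : Λ₀ ≠ 0 := by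
    intro h0
    rw [h0] at hLnorm
    have h1 : L = 0 := norm_le_zero_iff.1 (by simpa using hLnorm)
    apply hne
    rw [h0]
    refine Prod.ext (LinearMap.ext fun y => ?_) rfl
    rw [← hLΛ, h1]
    simp
  -- Stationarity is tested on `P (P γ)`. By symmetry of `P` the gradient term is `‖P γ‖ ^ 2`, and
  -- since `A P = 0` the constraint term only sees `A' - A`.
  have hPγ : ‖P γ‖ ≤ 2 * r * ‖γ‖ * (δ * a) := by
    have h1 : |Λ₀| * (‖P γ‖ * ‖P γ‖) ≤ |Λ₀| * (2 * r * ‖γ‖ * (δ * a) * ‖P γ‖) := by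
      have h2 : Λ₀ * inner ℝ (P γ) (P γ) = -L ((A' - A) (P (P γ))) := by
        have := hΛ (P (P γ))
        rw [_root_.sub_apply, hAP, sub_zero, hLΛ, hP]
        linarith
      have h3 : |Λ₀| * (‖P γ‖ * ‖P γ‖) = ‖L ((A' - A) (P (P γ)))‖ := by
        rw [← real_inner_self_eq_norm_mul_norm, ← norm_neg (L _), ← h2, norm_mul,
          Real.norm_eq_abs, Real.norm_of_nonneg real_inner_self_nonneg]
      rw [h3]
      calc _ ≤ ‖L‖ * (δ * (a * ‖P γ‖)) := (L.le_opNorm _).trans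
            (mul_le_mul_of_nonneg_left ((hdiff _).trans
              (mul_le_mul_of_nonneg_left (P.le_opNorm _) hδ0.le)) (norm_nonneg _))
        _ ≤ 2 * r * (|Λ₀| * ‖γ‖) * (δ * (a * ‖P γ‖)) :=
            mul_le_mul_of_nonneg_right hLnorm (by positivity)
        _ = _ := by ring
    have h2 := le_of_mul_le_mul_left h1 (abs_pos.2 hΛ₀)
    rcases (norm_nonneg (P γ)).eq_or_lt with h0 | h0
    · rw [← h0]; positivity
    · exact le_of_mul_le_mul_right h2 h0
  have hγn : ‖γ‖ ≤ ‖z‖ + (j + δ) * ‖d‖ := by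
    have h1 : γ = (γ - z - J d) + z + J d := by abel
    calc ‖γ‖ ≤ ‖γ - z - J d‖ + ‖z‖ + ‖J d‖ := by
          conv_lhs => rw [h1]
          exact norm_add₃_le
      _ ≤ δ * ‖d‖ + ‖z‖ + j * ‖d‖ := add_le_add (add_le_add hγ le_rfl) (J.le_opNorm d)
      _ = _ := by ring
  have hmain : ‖d + P z‖ ≤ δ * C * (‖d‖ + ‖z‖) := by
    -- This identity is `P J = 1 - R A` rearranged; each term on the right carries a factor `δ`.
    have h1 : d + P z = P γ + R (A d) - P (γ - z - J d) := by
      simp only [map_sub, hPJ]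
      abel
    have h2 : ‖R (A d)‖ ≤ r * (δ * ‖d‖) := (R.le_opNorm _).trans
      (mul_le_mul_of_nonneg_left hAd hr)
    have h3 : ‖P (γ - z - J d)‖ ≤ a * (δ * ‖d‖) := (P.le_opNorm _).trans
      (mul_le_mul_of_nonneg_left hγ ha)
    have h4 : ‖P γ‖ ≤ 2 * r * ((j + 2) * (‖d‖ + ‖z‖)) * (δ * a) := by
      refine hPγ.trans (mul_le_mul_of_nonneg_right (mul_le_mul_of_nonneg_left
        (hγn.trans ?_) (by positivity)) (by positivity))
      have := norm_nonneg d
      have := norm_nonneg z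
      nlinarith [mul_nonneg hj (norm_nonneg z), mul_nonneg (sub_nonneg.2 hδ1) (norm_nonneg d)]
    have h5 : ‖d + P z‖ ≤ ‖P γ‖ + ‖R (A d)‖ + ‖P (γ - z - J d)‖ := by
      rw [h1]
      exact (norm_sub_le _ _).trans (add_le_add (norm_add_le _ _) le_rfl)
    have h6 : 0 ≤ δ * ((r + a + 1) * ‖z‖ + ‖d‖) := by positivity
    rw [hC]
    linarith
  -- With `δ * C ≤ 1 / 2`, half of `‖d‖` moves to the left. Thus `d` is of the order of `z`, which
  -- removes `‖d‖` from the error bound.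
  have hd : ‖d‖ ≤ (2 * a + 1) * ‖z‖ := by
    have h1 : ‖d‖ ≤ ‖d + P z‖ + a * ‖z‖ := by
      calc ‖d‖ = ‖(d + P z) - P z‖ := by rw [add_sub_cancel_right]
        _ ≤ ‖d + P z‖ + ‖P z‖ := norm_sub_le _ _
        _ ≤ _ := add_le_add le_rfl (P.le_opNorm z)
    have h2 := mul_le_mul_of_nonneg_right hδC (add_nonneg (norm_nonneg d) (norm_nonneg z))
    linarith
  calc ‖d + P z‖ ≤ δ * C * (‖d‖ + ‖z‖) := hmain
    _ ≤ δ * C * ((2 * a + 2) * ‖z‖) :=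
        mul_le_mul_of_nonneg_left (by linarith) (by positivity)
    _ = δ * C * (2 * a + 2) * ‖z‖ := by ring
    _ ≤ ε * ‖z‖ := mul_le_mul_of_nonneg_right hδε (norm_nonneg _)

end Stationary

/-! ### Consistency and asymptotic normality of constrained M-estimators. -/

section MEstimation

variable {p : ℕ} {𝒳 : Type*} [MeasurableSpace 𝒳]

/-- The criterion `v` under the law `ν`: near `θ₀` it has integrable quadratic approximations, its
gradient `z` at `θ₀` is centred and square integrable, and its mean Hessian at `θ₀` is `J`. -/
structure RegularCriterion (ν : Measure 𝒳) (v : 𝒳 → E p → ℝ) (θ₀ : E p) (ρ : ℝ) (z : 𝒳 → E p)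
    (H : 𝒳 → E p →L[ℝ] E p) (b : 𝒳 → ℝ) (J : E p →L[ℝ] E p) : Prop where
  pos : 0 < ρ
  approx : ∀ᵐ x ∂ν, QuadApprox (v x) θ₀ ρ (z x) (H x) (b x)
  memLp : MemLp z 2 ν
  mean_zero : ∀ j, ∫ x, z x j ∂ν = 0
  integrable_hessian : Integrable H ν
  mean_hessian : ∫ x, H x ∂ν = J
  integrable_bound : Integrable b ν

/-- The average of the criterion over the first `n` observations. -/
def average {Ω : Type*} (v : 𝒳 → E p → ℝ) (X : ℕ → Ω → 𝒳) (n : ℕ) (w : Ω) (θ : E p) : ℝ :=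
  (n : ℝ)⁻¹ * ∑ i ∈ Finset.range n, v (X i w) θ

variable {Ω : Type*} [MeasurableSpace Ω] {Pr : Measure Ω} [IsProbabilityMeasure Pr]
  {ν : Measure 𝒳} {X : ℕ → Ω → 𝒳} {v : 𝒳 → E p → ℝ} {θ₀ : E p} {ρ : ℝ} {z : 𝒳 → E p}
  {H : 𝒳 → E p →L[ℝ] E p} {b : 𝒳 → ℝ} {J : E p →L[ℝ] E p}

/-- Quadratic approximations add up, so the law of large numbers applied to `H`, `b` and `z`
controls the expansion of the average on the whole ball at once. -/
lemma RegularCriterion.average_approx (h : RegularCriterion ν v θ₀ ρ z H b J)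
    (hX : ∀ i, Measurable (X i)) (hindep : iIndepFun X Pr) (hlaw : ∀ i, Pr.map (X i) = ν)
    {δ : ℝ} (hδ : 0 < δ) :
    WithHighProbability Pr fun n w => ∃ (H' : E p →L[ℝ] E p) (b' : ℝ),
      QuadApprox (average v X n w) θ₀ ρ ((n : ℝ)⁻¹ • ∑ i ∈ Finset.range n, z (X i w)) H' b' ∧
      ‖H' - J‖ < δ ∧ b' ≤ |∫ x, b x ∂ν| + 1 ∧
      ‖(n : ℝ)⁻¹ • ∑ i ∈ Finset.range n, z (X i w)‖ < δ := by
  have hν : IsProbabilityMeasure ν := by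
    rw [← hlaw 0]; exact Measure.isProbabilityMeasure_map (hX 0).aemeasurable
  have hz : Integrable z ν := h.memLp.integrable (by norm_num)
  have hz0 : ∫ x, z x ∂ν = 0 := by
    ext j
    rw [eval_integral_piLp fun i => hz.eval_piLp i, h.mean_zero]
    rfl
  have hgood : ∀ᵐ w ∂Pr, ∀ i, QuadApprox (v (X i w)) θ₀ ρ (z (X i w)) (H (X i w)) (b (X i w)) :=
    ae_all_iff.2 fun i => ae_of_ae_map (hX i).aemeasurable (by rw [hlaw i]; exact h.approx)
  have h1 := withHighProbability_mean hX hindep hlaw h.integrable_hessian hδ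
  have h2 := withHighProbability_mean hX hindep hlaw h.integrable_bound one_pos
  have h3 := withHighProbability_mean hX hindep hlaw hz hδ
  rw [h.mean_hessian] at h1
  rw [hz0] at h3
  refine ((WithHighProbability.of_ae (Pr := Pr) fun _ => hgood).and (h1.and (h2.and h3))).mono ?_
  rintro n w ⟨hw, hH, hb, hzn⟩
  refine ⟨_, _, (QuadApprox.sum (s := Finset.range n) fun i _ => hw i).const_mul
    (c := (n : ℝ)⁻¹) (by positivity), hH, ?_, by simpa using hzn⟩
  have h4 := (abs_lt.1 (Real.norm_eq_abs _ ▸ hb)).2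
  have h5 := le_abs_self (∫ x, b x ∂ν)
  linarith

/-- Consistency of near minimizers on a small neighbourhood. -/
lemma RegularCriterion.tendstoInMeasure (h : RegularCriterion ν v θ₀ ρ z H b J)
    (hX : ∀ i, Measurable (X i)) (hindep : iIndepFun X Pr) (hlaw : ∀ i, Pr.map (X i) = ν)
    {c : ℝ} (hc : 0 < c) (hJ : ∀ d, 4 * c * ‖d‖ ^ 2 ≤ inner ℝ (J d) d)
    {ρ' : ℝ} (hρ' : ρ' < ρ) (hbρ : (|∫ x, b x ∂ν| + 1) * ρ' ≤ c / 2)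
    {est : ℕ → Ω → E p}
    (hest : WithHighProbability Pr fun n w => est n w ∈ Metric.closedBall θ₀ ρ' ∧
      average v X n w (est n w) ≤ average v X n w θ₀) :
    TendstoInMeasure Pr est atTop fun _ => θ₀ := by
  refine tendstoInMeasure_of_withHighProbability fun δ hδ => ?_
  -- The bound `c` is for the Hessian error; the bound `c * δ` on the gradient gives `c * ‖est - θ₀‖
  -- < c * δ`.
  have h1 := h.average_approx hX hindep hlaw (δ := min c (c * δ)) (by positivity)
  refine (h1.and hest).mono ?_
  rintro n w ⟨⟨H', b', hq, hH, hb, hz⟩, hmem, hle⟩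
  have hd : ‖est n w - θ₀‖ ≤ ρ' := by rwa [mem_closedBall_iff_norm] at hmem
  have hball : est n w ∈ Metric.ball θ₀ ρ := by
    rw [mem_ball_iff_norm]; exact hd.trans_lt hρ'
  have hb1 : b' * ‖est n w - θ₀‖ ≤ c / 2 :=
    (mul_le_mul_of_nonneg_right hb (norm_nonneg _)).trans
      ((mul_le_mul_of_nonneg_left hd (by positivity)).trans hbρ)
  have h2 := hq.norm_sub_le hJ (hH.le.trans (min_le_left _ _)) hball hb1 hle
  exact lt_of_mul_lt_mul_left (h2.trans_lt (hz.trans_le (min_le_right _ _))) hc.le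

/-- A local minimizer of `φ` on `{θ ∈ Θ | g θ = 0}` satisfies the Lagrange multiplier rule. -/
lemma exists_multiplier_of_isLocalMinOn {r : ℕ} {Θ : Set (E p)} (hΘ : IsOpen Θ) {g : E p → E r}
    (hg : ContDiffOn ℝ 1 g Θ) {φ : E p → ℝ} {θ : E p} (hφ : ContDiffAt ℝ 1 φ θ)
    (hθ : θ ∈ restricted Θ g) (hmin : IsLocalMinOn φ (restricted Θ g) θ) :
    ∃ (Λ : Module.Dual ℝ (E r)) (Λ₀ : ℝ), (Λ, Λ₀) ≠ 0 ∧
      ∀ x, Λ (fderiv ℝ g θ x) + Λ₀ * inner ℝ (grad φ θ) x = 0 := by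
  have hΘn : Θ ∈ 𝓝 θ := hΘ.mem_nhds hθ.1
  -- As `Θ` is a neighbourhood of `θ`, the restricted space is locally a level set of `g`. The
  -- resulting rule allows `Λ₀ = 0`, a case excluded by `exists_norm_add_le_of_stationary`.
  have hset : restricted Θ g = {t | g t = g θ} ∩ Θ := by
    ext t
    simp only [restricted, Set.mem_ofPred_eq, Set.mem_inter_iff, hθ.2]
    exact and_comm
  have hextr : IsLocalExtrOn φ {t | g t = g θ} θ := by
    refine Or.inl ?_
    unfold IsLocalMinOn at hmin
    rwa [hset, nhdsWithin_inter_of_mem' (mem_nhdsWithin_of_mem_nhds hΘn)] at hmin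
  obtain ⟨Λ, Λ₀, hne, hΛ⟩ := hextr.exists_linear_map_of_hasStrictFDerivAt
    ((hg.contDiffAt hΘn).hasStrictFDerivAt one_ne_zero) (hφ.hasStrictFDerivAt one_ne_zero)
  refine ⟨Λ, Λ₀, hne, fun x => ?_⟩
  rw [← fderiv_apply_eq_inner]
  exact hΛ x

/-- Asymptotic normality of consistent constrained local minimizers. -/
lemma RegularCriterion.asymptoticallyNormal (h : RegularCriterion ν v θ₀ ρ z H b J)
    (hX : ∀ i, Measurable (X i)) (hindep : iIndepFun X Pr) (hlaw : ∀ i, Pr.map (X i) = ν)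
    {r : ℕ} {Θ : Set (E p)} (hΘ : IsOpen Θ) {g : E p → E r} (hg : ContDiffOn ℝ 1 g Θ)
    (hθ₀ : θ₀ ∈ restricted Θ g) {P : E p →L[ℝ] E p} {R : E r →L[ℝ] E p}
    (hP : ∀ x y, inner ℝ (P x) y = inner ℝ x (P y))
    (hPJ : ∀ x, P (J x) = x - R (fderiv ℝ g θ₀ x)) (hAR : ∀ y, fderiv ℝ g θ₀ (R y) = y)
    (hAP : ∀ x, fderiv ℝ g θ₀ (P x) = 0)
    {S : Matrix (Fin p) (Fin p) ℝ} (hS : ∀ i j, ∫ x, P (z x) i * P (z x) j ∂ν = S i j)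
    {est : ℕ → Ω → E p} (hmeas : ∀ n, AEMeasurable (est n) Pr)
    (hest : WithHighProbability Pr fun n w => est n w ∈ restricted Θ g ∧
      IsLocalMinOn (average v X n w) (restricted Θ g) (est n w))
    (hcons : TendstoInMeasure Pr est atTop fun _ => θ₀) :
    AsymptoticallyNormal Pr est θ₀ S := by
  have hΘn : Θ ∈ 𝓝 θ₀ := hΘ.mem_nhds hθ₀.1
  have hz : Integrable z ν := by
    have hν : IsProbabilityMeasure ν := by
      rw [← hlaw 0]; exact Measure.isProbabilityMeasure_map (hX 0).aemeasurable
    exact h.memLp.integrable (by norm_num)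
  -- Asymptotic linearity: the estimation error is `-P` of the averaged gradient up to an
  -- arbitrarily small multiple of that gradient.
  have hlin : ∀ ε > 0, WithHighProbability Pr fun n w =>
      ‖(est n w - θ₀) + P ((n : ℝ)⁻¹ • ∑ i ∈ Finset.range n, z (X i w))‖
        ≤ ε * ‖(n : ℝ)⁻¹ • ∑ i ∈ Finset.range n, z (X i w)‖ := by
    intro ε hε
    obtain ⟨δ, hδ, hdet⟩ := exists_norm_add_le_of_stationary hP hPJ hAR hAP hε
    set M := |∫ x, b x ∂ν| + 1 with hM
    have hM0 : 0 < M := by positivity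
    have hcont : ContinuousAt (fderiv ℝ g) θ₀ :=
      ((hg.contDiffAt hΘn).fderiv_right (m := 0) (by norm_num)).continuousAt
    have ev1 : ∀ᶠ θ in 𝓝 θ₀, ‖fderiv ℝ g θ - fderiv ℝ g θ₀‖ ≤ δ := by
      filter_upwards [Metric.tendsto_nhds.1 hcont δ hδ] with θ hθ
      rw [dist_eq_norm] at hθ
      exact hθ.le
    have ev2 : ∀ᶠ θ in 𝓝 θ₀, ‖g θ - g θ₀ - fderiv ℝ g θ₀ (θ - θ₀)‖ ≤ δ * ‖θ - θ₀‖ :=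
      (((hg.contDiffAt hΘn).differentiableAt one_ne_zero).hasFDerivAt.isLittleO).def hδ
    -- On this radius the quadratic gradient error is at most `δ / 2 * ‖d‖`; the Hessian error
    -- supplies the other half of `δ`.
    have ev3 : ∀ᶠ θ in 𝓝 θ₀, ‖θ - θ₀‖ < min ρ (δ / (2 * M)) := by
      simp_rw [← mem_ball_iff_norm]
      exact Metric.ball_mem_nhds _ (lt_min h.pos (by positivity))
    obtain ⟨τ, hτ, hτb⟩ := Metric.eventually_nhds_iff_ball.1 (ev1.and (ev2.and ev3))
    have h1 := h.average_approx hX hindep hlaw (δ := δ / 2) (by positivity)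
    have h2 := withHighProbability_of_tendstoInMeasure hcons hτ
    refine ((h1.and h2).and hest).mono ?_
    rintro n w ⟨⟨⟨H', b', hq, hH, hb, -⟩, hd⟩, hmem, hmin⟩
    obtain ⟨hA, hgd, hdist⟩ := hτb _ (mem_ball_iff_norm.2 hd)
    have hball : est n w ∈ Metric.ball θ₀ ρ :=
      mem_ball_iff_norm.2 (hdist.trans_le (min_le_left _ _))
    refine hdet _ _ (grad (average v X n w) (est n w)) _ ?_ hA ?_
      (exists_multiplier_of_isLocalMinOn hΘ hg
        (hq.contDiffOn.contDiffAt (Metric.isOpen_ball.mem_nhds hball)) hmem hmin)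
    · set d := est n w - θ₀
      have h3 := hq.grad_le _ hball
      have h4 : ‖(H' - J) d‖ ≤ δ / 2 * ‖d‖ := ((H' - J).le_opNorm d).trans
        (mul_le_mul_of_nonneg_right hH.le (norm_nonneg _))
      have h5 : M * ‖d‖ ≤ δ / 2 := by
        have := (hdist.trans_le (min_le_right _ _)).le
        rw [le_div_iff₀ (by positivity)] at this
        linarith
      have h6 : b' * ‖d‖ ^ 2 ≤ δ / 2 * ‖d‖ := by
        rw [sq, ← mul_assoc]
        exact mul_le_mul_of_nonneg_right
          ((mul_le_mul_of_nonneg_right hb (norm_nonneg _)).trans h5) (norm_nonneg _)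
      rw [_root_.sub_apply] at h4
      calc _ = ‖(grad (average v X n w) (est n w)
              - (n : ℝ)⁻¹ • ∑ i ∈ Finset.range n, z (X i w) - H' d) + (H' d - J d)‖ := by
            congr 1; abel
        _ ≤ _ := norm_add_le _ _
        _ ≤ δ / 2 * ‖d‖ + δ / 2 * ‖d‖ := add_le_add (h3.trans h6) h4
        _ = δ * ‖d‖ := by ring
    -- Both values of `g` vanish, so the Taylor remainder of `g` is minus its linear term.
    · rwa [hmem.2, hθ₀.2, sub_zero, zero_sub, norm_neg] at hgd
  have hclt := tendstoInDistribution_multivariate hX hindep hlaw (φ := fun x => -P (z x))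
    (S := S) (P.comp_memLp' h.memLp).neg (fun j => by
      have : ∫ x, P (z x) j ∂ν = 0 := by
        have h1 : ∫ x, P (z x) ∂ν = 0 := by
          rw [P.integral_comp_comm hz]
          have : ∫ x, z x ∂ν = 0 := by
            ext j
            rw [eval_integral_piLp fun i => hz.eval_piLp i, h.mean_zero]
            rfl
          rw [this, map_zero]
        rw [← eval_integral_piLp fun i => (P.integrable_comp hz).eval_piLp i, h1]
        rfl
      simpa [integral_neg] using this) (fun i j => by simpa using hS i j)
  -- Needed only for the tightness of `√n` times the averaged gradient.
  have hcltz := tendstoInDistribution_multivariate hX hindep hlaw (φ := z)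
    (S := Matrix.of fun i j => ∫ x, z x i * z x j ∂ν) h.memLp h.mean_zero fun i j => rfl
  have hscale : ∀ (n : ℕ) (y : E p), (√(n : ℝ))⁻¹ • y = √(n : ℝ) • (n : ℝ)⁻¹ • y := by
    intro n y
    rw [smul_smul]
    congr 1
    rw [← div_eq_mul_inv, Real.sqrt_div_self', one_div]
  -- Slutsky: it remains to show that `√n` times the linearization error tends to zero in
  -- probability. Outside an event of measure at most `ε / 2` the scaled gradient is bounded by `a`,
  -- whence the tolerance `δ / (|a| + 1)`.
  refine tendstoInDistribution_of_tendstoInMeasure_sub _ _ hclt ?_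
    fun n => ((hmeas n).sub_const θ₀).const_smul (√(n : ℝ))
  refine tendstoInMeasure_of_withHighProbability (y := (0 : E p)) fun δ hδ => ?_
  refine ENNReal.tendsto_nhds_zero.2 fun ε hε => ?_
  have hε2 : 0 < ε / 2 := ENNReal.half_pos hε.ne'
  obtain ⟨a, ha⟩ := exists_norm_bound_of_tendstoInDistribution hcltz hε2
  have h1 := hlin (δ / (|a| + 1)) (by positivity)
  filter_upwards [ENNReal.tendsto_nhds_zero.1 h1 _ hε2] with n hn
  rw [← ENNReal.add_halves ε]
  refine (measure_mono ?_).trans ((measure_union_le _ _).trans (add_le_add hn (ha n)))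
  intro w hw
  by_contra hcon
  rw [Set.mem_union, not_or] at hcon
  obtain ⟨hc1, hc2⟩ := hcon
  simp only [Set.mem_ofPred_eq, not_not, not_lt] at hc1 hc2
  apply hw
  rw [hscale, norm_smul, Real.norm_of_nonneg (Real.sqrt_nonneg _)] at hc2
  simp only [Pi.sub_apply, sub_zero, Finset.sum_neg_distrib, smul_neg, sub_neg_eq_add]
  rw [hscale, ← map_sum, ← map_smul, ← smul_add, norm_smul,
    Real.norm_of_nonneg (Real.sqrt_nonneg _)]
  calc _ ≤ √(n : ℝ) * (δ / (|a| + 1) * ‖(n : ℝ)⁻¹ • ∑ i ∈ Finset.range n, z (X i w)‖) :=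
        mul_le_mul_of_nonneg_left hc1 (Real.sqrt_nonneg _)
    _ = δ / (|a| + 1) * (√(n : ℝ) * ‖(n : ℝ)⁻¹ • ∑ i ∈ Finset.range n, z (X i w)‖) := by ring
    _ ≤ δ / (|a| + 1) * |a| :=
        mul_le_mul_of_nonneg_left (hc2.trans (le_abs_self a)) (by positivity)
    _ < δ := by
        rw [div_mul_eq_mul_div, div_lt_iff₀ (by positivity)]
        nlinarith

end MEstimation

/-! ### Measurable selection of minimizers. -/

section MeasurableSelection

variable {p : ℕ} {𝒴 : Type*} [MeasurableSpace 𝒴]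

/-- A strict inequality is an open condition on `θ`, so a countable dense subset of `K` detects it.
-/
lemma measurableSet_exists_lt {K : Set (E p)} {F : 𝒴 → E p → ℝ}
    (hF : ∀ θ ∈ K, Measurable fun y => F y θ) (hc : ∀ y, ContinuousOn (F y) K) (c : ℝ) :
    MeasurableSet {y | ∃ θ ∈ K, F y θ < c} := by
  obtain ⟨D, hDc, hDd⟩ := TopologicalSpace.exists_countable_dense K
  have : {y | ∃ θ ∈ K, F y θ < c} = ⋃ d ∈ D, {y | F y (d : K) < c} := by
    ext y
    simp only [Set.mem_ofPred_eq, Set.mem_iUnion]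
    constructor
    · rintro ⟨θ, hθ, hlt⟩
      have hcont : Continuous fun t : K => F y t := (hc y).domRestrict
      obtain ⟨d, hd, hdD⟩ := hDd.inter_open_nonempty _ (isOpen_Iio.preimage hcont) ⟨⟨θ, hθ⟩, hlt⟩
      exact ⟨d, hdD, hd⟩
    · rintro ⟨d, -, hlt⟩
      exact ⟨d, d.2, hlt⟩
  rw [this]
  exact MeasurableSet.biUnion hDc fun d _ => measurableSet_lt (hF d d.2) measurable_const

/-- The minimum over a compact set is attained, so approximate solutions for every tolerance `1 / (n
+ 1)` yield an exact one. -/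
lemma measurableSet_exists_le {K : Set (E p)} (hK : IsCompact K) {F : 𝒴 → E p → ℝ}
    (hF : ∀ θ ∈ K, Measurable fun y => F y θ) (hc : ∀ y, ContinuousOn (F y) K) (c : ℝ) :
    MeasurableSet {y | ∃ θ ∈ K, F y θ ≤ c} := by
  have : {y | ∃ θ ∈ K, F y θ ≤ c} = ⋂ n : ℕ, {y | ∃ θ ∈ K, F y θ < c + 1 / ((n : ℝ) + 1)} := by
    ext y
    simp only [Set.mem_ofPred_eq, Set.mem_iInter]
    constructor
    · rintro ⟨θ, hθ, hle⟩ n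
      exact ⟨θ, hθ, hle.trans_lt (lt_add_of_pos_right _ Nat.one_div_pos_of_nat)⟩
    · intro hy
      obtain ⟨θ₁, hθ₁, -⟩ := hy 0
      obtain ⟨θ, hθ, hmin⟩ := hK.exists_isMinOn ⟨θ₁, hθ₁⟩ (hc y)
      refine ⟨θ, hθ, le_of_forall_pos_le_add fun ε hε => ?_⟩
      obtain ⟨n, hn⟩ := exists_nat_one_div_lt hε
      obtain ⟨θ', hθ', hlt⟩ := hy n
      have := isMinOn_iff.1 hmin θ' hθ'
      linarith
  rw [this]
  exact MeasurableSet.iInter fun n => measurableSet_exists_lt hF hc _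

/-- Measurable selection of minimizers over a compact set of a function that is continuous in one
variable and measurable in the other. -/
lemma exists_measurable_isMinOn {C : Set (E p)} (hC : IsCompact C) (hne : C.Nonempty)
    {F : 𝒴 → E p → ℝ} (hF : ∀ θ ∈ C, Measurable fun y => F y θ)
    (hc : ∀ y, ContinuousOn (F y) C) :
    ∃ T : 𝒴 → E p, Measurable T ∧ ∀ y, T y ∈ C ∧ IsMinOn (F y) C (T y) := by
  have hbdd : ∀ y, BddBelow (F y '' C) := fun y => (hC.image_of_continuousOn (hc y)).bddBelow
  have hm : Measurable fun y => sInf (F y '' C) := by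
    refine measurable_of_Iio fun c => ?_
    have : (fun y => sInf (F y '' C)) ⁻¹' Set.Iio c = {y | ∃ θ ∈ C, F y θ < c} := by
      ext y
      simp [csInf_lt_iff (hbdd y) (hne.image _)]
    rw [this]
    exact measurableSet_exists_lt hF hc c
  -- The selected point is the lexicographically smallest minimizer. Its coordinates are fixed one
  -- at a time; after `k` steps some minimizer agrees with the first `k` selected coordinates.
  have key : ∀ k ≤ p, ∃ t : Fin p → 𝒴 → ℝ, (∀ i, Measurable (t i)) ∧
      ∀ y, ∃ θ ∈ C, IsMinOn (F y) C θ ∧ ∀ i : Fin p, i.val < k → θ i = t i y := by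
    intro k
    induction k with
    | zero =>
      intro _
      refine ⟨fun _ _ => 0, fun _ => measurable_const, fun y => ?_⟩
      obtain ⟨θ, hθ, hmin⟩ := hC.exists_isMinOn hne (hc y)
      exact ⟨θ, hθ, hmin, fun i hi => absurd hi (Nat.not_lt_zero _)⟩
    | succ k ih =>
      intro hk
      obtain ⟨t, ht, hsel⟩ := ih (Nat.le_of_succ_le hk)
      let κ : Fin p := ⟨k, hk⟩
      let I : Finset (Fin p) := Finset.univ.filter fun i => i.val < k
      -- A nonnegative penalty on `C` whose zeros are exactly the minimizers with the prescribed
      -- first `k` coordinates.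
      let F' : 𝒴 → E p → ℝ := fun y θ => F y θ - sInf (F y '' C) + ∑ i ∈ I, |θ i - t i y|
      have hF' : ∀ θ ∈ C, Measurable fun y => F' y θ := fun θ hθ =>
        ((hF θ hθ).sub hm).add
          (Finset.measurable_fun_sum _ fun i _ => ((ht i).const_sub (θ i)).abs)
      have hc' : ∀ y, ContinuousOn (F' y) C := fun y =>
        ((hc y).sub continuousOn_const).add (by fun_prop)
      have hzero : ∀ y, ∀ θ ∈ C,
          (F' y θ ≤ 0 ↔ IsMinOn (F y) C θ ∧ ∀ i : Fin p, i.val < k → θ i = t i y) := by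
        intro y θ hθ
        have h1 : sInf (F y '' C) ≤ F y θ := csInf_le (hbdd y) ⟨θ, hθ, rfl⟩
        have h2 : 0 ≤ ∑ i ∈ I, |θ i - t i y| := Finset.sum_nonneg fun i _ => abs_nonneg _
        constructor
        · intro h
          have h3 : F y θ - sInf (F y '' C) + ∑ i ∈ I, |θ i - t i y| ≤ 0 := h
          refine ⟨isMinOn_iff.2 fun θ' hθ' => ?_, fun i hi => ?_⟩
          · have := csInf_le (hbdd y) ⟨θ', hθ', rfl⟩
            linarith
          · have h4 : ∑ i ∈ I, |θ i - t i y| = 0 := by linarith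
            have := (Finset.sum_eq_zero_iff_of_nonneg fun i _ => abs_nonneg _).1 h4 i
              (Finset.mem_filter.2 ⟨Finset.mem_univ _, hi⟩)
            exact sub_eq_zero.1 (abs_eq_zero.1 this)
        · rintro ⟨hmin, hi⟩
          have h3 : F y θ ≤ sInf (F y '' C) := le_csInf (hne.image _) (by
            rintro _ ⟨θ', hθ', rfl⟩
            exact isMinOn_iff.1 hmin θ' hθ')
          have h4 : ∑ i ∈ I, |θ i - t i y| = 0 := Finset.sum_eq_zero fun i hi' => by
            rw [hi i (Finset.mem_filter.1 hi').2, sub_self, abs_zero]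
          change F y θ - sInf (F y '' C) + ∑ i ∈ I, |θ i - t i y| ≤ 0
          linarith
      let A : 𝒴 → Set (E p) := fun y => {θ | θ ∈ C ∧ F' y θ ≤ 0}
      have hA : ∀ y, IsCompact (A y) := fun y => by
        have : A y = C ∩ F' y ⁻¹' Set.Iic 0 := rfl
        rw [this]
        exact hC.of_isClosed_subset ((hc' y).preimage_isClosed_of_isClosed hC.isClosed isClosed_Iic)
          Set.inter_subset_left
      have hcoord : Continuous fun θ : E p => θ κ := by fun_prop
      have hAne : ∀ y, (A y).Nonempty := fun y => by
        obtain ⟨θ, hθ, h⟩ := hsel y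
        exact ⟨θ, hθ, (hzero y θ hθ).2 h⟩
      choose θs hθs hθmin using fun y => (hA y).exists_isMinOn (hAne y) hcoord.continuousOn
      -- The point `θs y` is an arbitrary choice, but its coordinate `κ` is the minimal value, and
      -- its sublevel sets are existence statements over compact sets.
      have hs : Measurable fun y => θs y κ := by
        refine measurable_of_Iic fun c => ?_
        have : (fun y => θs y κ) ⁻¹' Set.Iic c
            = {y | ∃ θ ∈ C ∩ {θ | θ κ ≤ c}, F' y θ ≤ 0} := by
          ext y
          constructor
          · intro hy
            exact ⟨θs y, ⟨(hθs y).1, hy⟩, (hθs y).2⟩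
          · rintro ⟨θ, ⟨hθ, hle⟩, h0⟩
            exact (isMinOn_iff.1 (hθmin y) θ ⟨hθ, h0⟩).trans hle
        rw [this]
        exact measurableSet_exists_le (hC.inter_right (isClosed_le hcoord continuous_const))
          (fun θ hθ => hF' θ hθ.1) (fun y => (hc' y).mono Set.inter_subset_left) 0
      refine ⟨fun i y => if i = κ then θs y κ else t i y, fun i => ?_, fun y => ?_⟩
      · by_cases hi : i = κ
        · simpa [hi] using hs
        · simpa [hi] using ht i
      · obtain ⟨hmin, heq⟩ := (hzero y _ (hθs y).1).1 (hθs y).2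
        refine ⟨θs y, (hθs y).1, hmin, fun i hi => ?_⟩
        by_cases hiκ : i = κ
        · simp [hiκ]
        · have : i.val ≠ k := fun h => hiκ (Fin.ext h)
          simpa [hiκ] using heq i (by omega)
  obtain ⟨t, ht, hsel⟩ := key p le_rfl
  refine ⟨fun y => WithLp.toLp 2 fun i => t i y, ?_, fun y => ?_⟩
  · exact (WithLp.measurable_toLp 2 _).comp (measurable_pi_lambda _ ht)
  · obtain ⟨θ, hθ, hmin, heq⟩ := hsel y
    have : WithLp.toLp 2 (fun i => t i y) = θ := by
      ext i
      exact (heq i i.2).symm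
    dsimp only
    rw [this]
    exact ⟨hθ, hmin⟩

end MeasurableSelection

/-! ### Positive definiteness and the restricted information matrices. -/

section LinearAlgebra

variable {p r : ℕ}

/-- The form attains a positive minimum on the unit sphere and is homogeneous of degree two. The
factor `4` matches `QuadApprox.norm_sub_le`. -/
lemma exists_quadratic_lower_bound {A : Matrix (Fin p) (Fin p) ℝ} (hA : A.PosDef) :
    ∃ c > 0, ∀ d : E p, 4 * c * ‖d‖ ^ 2
      ≤ inner ℝ (Matrix.toEuclideanCLM (𝕜 := ℝ) A d) d := by
  set q : E p → ℝ := fun d => inner ℝ (Matrix.toEuclideanCLM (𝕜 := ℝ) A d) d with hq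
  have hqc : Continuous q := by fun_prop
  have hpos : ∀ d : E p, d ≠ 0 → 0 < q d := by
    intro d hd
    have h1 : q d = d.ofLp ⬝ᵥ A.mulVec d.ofLp := by
      rw [hq, ← Matrix.inner_toEuclideanCLM]
      exact real_inner_comm _ _
    rw [h1]
    have := hA.dotProduct_mulVec_pos (x := d.ofLp) (by simpa using hd)
    simpa using this
  have hsph : ∃ m > 0, ∀ d ∈ Metric.sphere (0 : E p) 1, m ≤ q d := by
    rcases (Metric.sphere (0 : E p) 1).eq_empty_or_nonempty with h0 | hne
    · exact ⟨1, one_pos, by simp [h0]⟩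
    · obtain ⟨d₀, hd₀, hmin⟩ := (isCompact_sphere (0 : E p) 1).exists_isMinOn hne hqc.continuousOn
      refine ⟨q d₀, hpos d₀ ?_, fun d hd => isMinOn_iff.1 hmin d hd⟩
      rintro rfl
      simp at hd₀
  obtain ⟨m, hm, hle⟩ := hsph
  refine ⟨m / 4, by positivity, fun d => ?_⟩
  change 4 * (m / 4) * ‖d‖ ^ 2 ≤ q d
  rcases eq_or_ne d 0 with rfl | hd
  · simp [hq]
  · have hn : 0 < ‖d‖ := norm_pos_iff.2 hd
    have h1 := hle (‖d‖⁻¹ • d) (by simp [norm_smul, hn.ne'])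
    have h2 : q (‖d‖⁻¹ • d) = ‖d‖⁻¹ ^ 2 * q d := by
      simp only [hq, map_smul, real_inner_smul_left, real_inner_smul_right]
      ring
    rw [h2] at h1
    have h3 := mul_le_mul_of_nonneg_right h1 (sq_nonneg ‖d‖)
    have h4 : ‖d‖⁻¹ ^ 2 * q d * ‖d‖ ^ 2 = q d := by field_simp
    linarith

/-- The algebra of the restricted information matrices. -/
lemma restricted_information {A : Matrix (Fin p) (Fin p) ℝ} (hA : A.PosDef)
    {B : Matrix (Fin p) (Fin r) ℝ} (hB : B.rank = r) {Q : Matrix (Fin p) (Fin r) ℝ}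
    (hQ : Q = A⁻¹ * B * (B.transpose * A⁻¹ * B)⁻¹) {P : Matrix (Fin p) (Fin p) ℝ}
    (hP : P = A⁻¹ - Q * B.transpose * A⁻¹) :
    P.transpose = P ∧ P * A = 1 - Q * B.transpose ∧ B.transpose * Q = 1 ∧
      B.transpose * P = 0 := by
  -- Full column rank makes `Bᵀ A⁻¹ B` positive definite, hence invertible.
  have hinj : Function.Injective B.mulVec := by
    rw [Matrix.mulVec_injective_iff, linearIndependent_iff_card_eq_finrank_span,
      Set.finrank, ← Matrix.rank_eq_finrank_span_cols, hB, Fintype.card_fin]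
  have hN : (B.transpose * A⁻¹ * B).PosDef := by
    have := hA.inv.conjTranspose_mul_mul_same hinj
    rwa [Matrix.conjTranspose_eq_transpose_of_trivial] at this
  have hAdet : IsUnit A.det := hA.det_pos.ne'.isUnit
  have hNdet : IsUnit (B.transpose * A⁻¹ * B).det := hN.det_pos.ne'.isUnit
  have hAi : A⁻¹.transpose = A⁻¹ := by
    have := hA.inv.isHermitian.eq
    rwa [Matrix.conjTranspose_eq_transpose_of_trivial] at this
  have hNi : ((B.transpose * A⁻¹ * B)⁻¹).transpose = (B.transpose * A⁻¹ * B)⁻¹ := by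
    have := hN.inv.isHermitian.eq
    rwa [Matrix.conjTranspose_eq_transpose_of_trivial] at this
  have hBQ : B.transpose * Q = 1 := by
    rw [hQ, ← Matrix.mul_assoc, ← Matrix.mul_assoc, Matrix.mul_nonsing_inv _ hNdet]
  refine ⟨?_, ?_, hBQ, ?_⟩
  · rw [hP, hQ]
    simp only [Matrix.transpose_sub, Matrix.transpose_mul, Matrix.transpose_transpose, hAi, hNi]
    simp only [Matrix.mul_assoc]
  · rw [hP, Matrix.sub_mul, Matrix.mul_assoc _ A⁻¹ A, Matrix.nonsing_inv_mul _ hAdet,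
      Matrix.mul_one]
  · rw [hP, Matrix.mul_sub, ← Matrix.mul_assoc, ← Matrix.mul_assoc, hBQ, Matrix.one_mul, sub_self]

end LinearAlgebra

/-! ### Partial derivatives of logarithms and powers. -/

section Calculus

variable {p : ℕ} {s : Set (E p)}

lemma pd_congr {F F' : E p → ℝ} {θ : E p} (h : F =ᶠ[𝓝 θ] F') (j : Fin p) :
    pd j F θ = pd j F' θ := by
  rw [pd, pd, h.fderiv_eq]

lemma pd_congr_of_eqOn (hs : IsOpen s) {F F' : E p → ℝ} (h : ∀ θ ∈ s, F θ = F' θ) {θ : E p}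
    (hθ : θ ∈ s) (j : Fin p) : pd j F θ = pd j F' θ :=
  pd_congr (eventually_of_mem (hs.mem_nhds hθ) h) j

lemma pd_sub {F F' : E p → ℝ} {θ : E p} (h : DifferentiableAt ℝ F θ)
    (h' : DifferentiableAt ℝ F' θ) (j : Fin p) :
    pd j (fun t => F t - F' t) θ = pd j F θ - pd j F' θ := by
  simp [pd, fderiv_fun_sub h h']

lemma pd_const_mul {F : E p → ℝ} {θ : E p} (h : DifferentiableAt ℝ F θ) (c : ℝ) (j : Fin p) :
    pd j (fun t => c * F t) θ = c * pd j F θ := by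
  simp [pd, fderiv_const_mul h]

lemma pd_mul {F F' : E p → ℝ} {θ : E p} (h : DifferentiableAt ℝ F θ)
    (h' : DifferentiableAt ℝ F' θ) (j : Fin p) :
    pd j (fun t => F t * F' t) θ = F θ * pd j F' θ + pd j F θ * F' θ := by
  simp [pd, fderiv_fun_mul h h', mul_comm]

lemma pd_const (c : ℝ) (θ : E p) (j : Fin p) : pd j (fun _ => c) θ = 0 := by
  simp [pd]

lemma contDiffOn_pd (hs : IsOpen s) {F : E p → ℝ} {m n : WithTop ℕ∞} (h : ContDiffOn ℝ n F s)
    (hmn : m + 1 ≤ n) (j : Fin p) : ContDiffOn ℝ m (pd j F) s :=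
  (h.fderiv_of_isOpen hs hmn).clm_apply contDiffOn_const

/-- `F` and its partial derivatives of orders one and two are differentiable on `s`. -/
structure ThriceDifferentiableOn (F : E p → ℝ) (s : Set (E p)) : Prop where
  differentiableOn : DifferentiableOn ℝ F s
  pd : ∀ l, DifferentiableOn ℝ (pd l F) s
  pd_pd : ∀ k l, DifferentiableOn ℝ (DPD.pd k (DPD.pd l F)) s

lemma ThriceDifferentiableOn.of_contDiffOn (hs : IsOpen s) {F : E p → ℝ}
    (h : ContDiffOn ℝ 3 F s) : ThriceDifferentiableOn F s where
  differentiableOn := h.differentiableOn (by norm_num)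
  pd l := (contDiffOn_pd hs h (m := 2) (by norm_num) l).differentiableOn (by norm_num)
  pd_pd k l := (contDiffOn_pd hs (contDiffOn_pd hs h (m := 2) (by norm_num) l) (m := 1)
    (by norm_num) k).differentiableOn (by norm_num)

lemma ThriceDifferentiableOn.pd_sub {F F' : E p → ℝ} (hs : IsOpen s)
    (h : ThriceDifferentiableOn F s) (h' : ThriceDifferentiableOn F' s) {θ : E p} (hθ : θ ∈ s)
    (l : Fin p) : DPD.pd l (fun t => F t - F' t) θ = DPD.pd l F θ - DPD.pd l F' θ :=
  DPD.pd_sub (h.differentiableOn.differentiableAt (hs.mem_nhds hθ))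
    (h'.differentiableOn.differentiableAt (hs.mem_nhds hθ)) l

lemma ThriceDifferentiableOn.pd_pd_sub {F F' : E p → ℝ} (hs : IsOpen s)
    (h : ThriceDifferentiableOn F s) (h' : ThriceDifferentiableOn F' s) {θ : E p} (hθ : θ ∈ s)
    (k l : Fin p) : DPD.pd k (DPD.pd l fun t => F t - F' t) θ
      = DPD.pd k (DPD.pd l F) θ - DPD.pd k (DPD.pd l F') θ := by
  rw [pd_congr_of_eqOn hs (fun t ht => h.pd_sub hs h' ht l) hθ]
  exact DPD.pd_sub ((h.pd l).differentiableAt (hs.mem_nhds hθ))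
    ((h'.pd l).differentiableAt (hs.mem_nhds hθ)) k

lemma ThriceDifferentiableOn.sub {F F' : E p → ℝ} (hs : IsOpen s)
    (h : ThriceDifferentiableOn F s) (h' : ThriceDifferentiableOn F' s) :
    ThriceDifferentiableOn (fun t => F t - F' t) s where
  differentiableOn := h.differentiableOn.sub h'.differentiableOn
  pd l := ((h.pd l).sub (h'.pd l)).congr fun _ ht => h.pd_sub hs h' ht l
  pd_pd k l := ((h.pd_pd k l).sub (h'.pd_pd k l)).congr fun _ ht => h.pd_pd_sub hs h' ht k l

variable {φ : E p → ℝ}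

lemma contDiffOn_log (hφ : ContDiffOn ℝ 3 φ s) (hpos : ∀ θ ∈ s, 0 < φ θ) :
    ContDiffOn ℝ 3 (fun t => Real.log (φ t)) s :=
  hφ.log fun θ hθ => (hpos θ hθ).ne'

lemma contDiffOn_rpow_const (hφ : ContDiffOn ℝ 3 φ s) (hpos : ∀ θ ∈ s, 0 < φ θ) (a : ℝ) :
    ContDiffOn ℝ 3 (fun t => φ t ^ a) s :=
  hφ.rpow_const_of_ne fun θ hθ => (hpos θ hθ).ne'

/-- Writing the power as `exp (a * log φ)` brings out the score, in terms of which `J`, `ξ` and `K`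
are defined. -/
lemma pd_rpow (hs : IsOpen s) (hφ : ContDiffOn ℝ 3 φ s) (hpos : ∀ θ ∈ s, 0 < φ θ) (a : ℝ)
    {θ : E p} (hθ : θ ∈ s) (i : Fin p) :
    pd i (fun t => φ t ^ a) θ = a * (pd i (fun t => Real.log (φ t)) θ * φ θ ^ a) := by
  have hlog : DifferentiableAt ℝ (fun t => Real.log (φ t)) θ :=
    ((contDiffOn_log hφ hpos).differentiableOn (by norm_num)).differentiableAt (hs.mem_nhds hθ)
  have hrep : ∀ t ∈ s, φ t ^ a = Real.exp (a * Real.log (φ t)) := fun t ht => by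
    rw [Real.rpow_def_of_pos (hpos t ht), mul_comm]
  rw [pd_congr_of_eqOn hs hrep hθ, hrep θ hθ, pd, fderiv_exp (hlog.const_mul a),
    fderiv_const_mul hlog]
  simp only [pd, _root_.smul_apply, smul_eq_mul]
  ring

lemma pd_score_mul_rpow (hs : IsOpen s) (hφ : ContDiffOn ℝ 3 φ s) (hpos : ∀ θ ∈ s, 0 < φ θ)
    (a : ℝ) {θ : E p} (hθ : θ ∈ s) (i j : Fin p) :
    pd j (fun t => pd i (fun t => Real.log (φ t)) t * φ t ^ a) θ
      = (pd j (pd i fun t => Real.log (φ t)) θ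
          + a * (pd i (fun t => Real.log (φ t)) θ * pd j (fun t => Real.log (φ t)) θ))
        * φ θ ^ a := by
  have h1 : DifferentiableAt ℝ (pd i fun t => Real.log (φ t)) θ :=
    ((ThriceDifferentiableOn.of_contDiffOn hs (contDiffOn_log hφ hpos)).pd i).differentiableAt
      (hs.mem_nhds hθ)
  have h2 : DifferentiableAt ℝ (fun t => φ t ^ a) θ :=
    ((contDiffOn_rpow_const hφ hpos a).differentiableOn (by norm_num)).differentiableAt
      (hs.mem_nhds hθ)
  rw [pd_mul h1 h2, pd_rpow hs hφ hpos a hθ]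
  ring

lemma pd_pd_rpow (hs : IsOpen s) (hφ : ContDiffOn ℝ 3 φ s) (hpos : ∀ θ ∈ s, 0 < φ θ) (a : ℝ)
    {θ : E p} (hθ : θ ∈ s) (i j : Fin p) :
    pd j (pd i fun t => φ t ^ a) θ
      = a * ((pd j (pd i fun t => Real.log (φ t)) θ
          + a * (pd i (fun t => Real.log (φ t)) θ * pd j (fun t => Real.log (φ t)) θ))
        * φ θ ^ a) := by
  have h1 : DifferentiableAt ℝ (pd i fun t => Real.log (φ t)) θ :=
    ((ThriceDifferentiableOn.of_contDiffOn hs (contDiffOn_log hφ hpos)).pd i).differentiableAt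
      (hs.mem_nhds hθ)
  have h2 : DifferentiableAt ℝ (fun t => φ t ^ a) θ :=
    ((contDiffOn_rpow_const hφ hpos a).differentiableOn (by norm_num)).differentiableAt
      (hs.mem_nhds hθ)
  rw [pd_congr_of_eqOn hs (fun t ht => pd_rpow hs hφ hpos a ht i) hθ, pd_const_mul (h1.fun_mul h2),
    pd_score_mul_rpow hs hφ hpos a hθ]

end Calculus

/-! ### Regularity of the density power divergence criterion. -/

section Model

variable {p : ℕ} {𝒳 : Type*} [MeasurableSpace 𝒳] {μ : Measure 𝒳} {f : E p → 𝒳 → ℝ} {θ : E p}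

lemma ae_modelMeasure_iff (hf : Measurable (f θ)) {q : 𝒳 → Prop} :
    (∀ᵐ x ∂modelMeasure μ f θ, q x) ↔ ∀ᵐ x ∂μ, 0 < f θ x → q x := by
  rw [modelMeasure, ae_withDensity_iff hf.ennreal_ofReal]
  simp

lemma integral_modelMeasure (hf : Measurable (f θ)) (hf0 : ∀ x, 0 ≤ f θ x) (h : 𝒳 → ℝ) :
    ∫ x, h x ∂modelMeasure μ f θ = ∫ x, h x * f θ x ∂μ := by
  rw [modelMeasure, integral_withDensity_eq_integral_toReal_smul hf.ennreal_ofReal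
    (ae_of_all _ fun x => ENNReal.ofReal_lt_top)]
  refine integral_congr_ae (ae_of_all _ fun x => ?_)
  simp [ENNReal.toReal_ofReal (hf0 x), mul_comm]

lemma integrable_modelMeasure_iff (hf : Measurable (f θ)) (hf0 : ∀ x, 0 ≤ f θ x) {h : 𝒳 → ℝ} :
    Integrable h (modelMeasure μ f θ) ↔ Integrable (fun x => h x * f θ x) μ := by
  rw [modelMeasure, integrable_withDensity_iff hf.ennreal_ofReal
    (ae_of_all _ fun x => ENNReal.ofReal_lt_top)]
  simp [ENNReal.toReal_ofReal (hf0 _)]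

/-- The part of the criterion that depends on the observation, with the opposite sign. -/
def observationTerm (β : ℝ) (φ : E p → ℝ) (t : E p) : ℝ :=
  if β = 0 then Real.log (φ t) else (1 + 1 / β) * φ t ^ β

/-- The part of the criterion that does not depend on the observation. -/
def integralTerm (μ : Measure 𝒳) (f : E p → 𝒳 → ℝ) (β : ℝ) (t : E p) : ℝ :=
  if β = 0 then 0 else ∫ y, f t y ^ (1 + β) ∂μ

lemma V_eq (β : ℝ) (x : 𝒳) : (fun t => V μ f β t x)
    = fun t => integralTerm μ f β t - observationTerm β (fun t => f t x) t := by
  funext t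
  unfold V integralTerm observationTerm
  split_ifs <;> simp

section ObservationTerm

variable {s : Set (E p)} {φ : E p → ℝ} {β : ℝ}

lemma contDiffOn_observationTerm (hφ : ContDiffOn ℝ 3 φ s) (hpos : ∀ θ ∈ s, 0 < φ θ) :
    ContDiffOn ℝ 3 (observationTerm β φ) s := by
  unfold observationTerm
  split_ifs
  · exact contDiffOn_log hφ hpos
  · exact contDiffOn_const.mul (contDiffOn_rpow_const hφ hpos β)

/-- Since `(1 + 1 / β) * β = 1 + β`, the power and logarithmic criteria share one gradient formula,
which lets the case `β = 0` be treated together with `β > 0`. -/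
lemma pd_observationTerm (hs : IsOpen s) (hφ : ContDiffOn ℝ 3 φ s) (hpos : ∀ θ ∈ s, 0 < φ θ)
    (hθ : θ ∈ s) (i : Fin p) : pd i (observationTerm β φ) θ
      = (1 + β) * (pd i (fun t => Real.log (φ t)) θ * φ θ ^ β) := by
  by_cases hβ : β = 0
  · have : observationTerm β φ = fun t => Real.log (φ t) := by
      funext t
      simp [observationTerm, hβ]
    rw [this, hβ]
    simp
  · have : observationTerm β φ = fun t => (1 + 1 / β) * φ t ^ β := by
      funext t
      simp [observationTerm, hβ]
    rw [this, pd_const_mul (((contDiffOn_rpow_const hφ hpos β).differentiableOn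
      (by norm_num)).differentiableAt (hs.mem_nhds hθ)), pd_rpow hs hφ hpos β hθ]
    field_simp
    ring

lemma pd_pd_observationTerm (hs : IsOpen s) (hφ : ContDiffOn ℝ 3 φ s) (hpos : ∀ θ ∈ s, 0 < φ θ)
    (hθ : θ ∈ s) (i j : Fin p) : pd j (pd i (observationTerm β φ)) θ
      = (1 + β) * ((pd j (pd i fun t => Real.log (φ t)) θ
          + β * (pd i (fun t => Real.log (φ t)) θ * pd j (fun t => Real.log (φ t)) θ))
        * φ θ ^ β) := by
  have h1 : DifferentiableAt ℝ (pd i fun t => Real.log (φ t)) θ :=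
    ((ThriceDifferentiableOn.of_contDiffOn hs (contDiffOn_log hφ hpos)).pd i).differentiableAt
      (hs.mem_nhds hθ)
  have h2 : DifferentiableAt ℝ (fun t => φ t ^ β) θ :=
    ((contDiffOn_rpow_const hφ hpos β).differentiableOn (by norm_num)).differentiableAt
      (hs.mem_nhds hθ)
  rw [pd_congr_of_eqOn hs (fun t ht => pd_observationTerm hs hφ hpos ht i) hθ,
    pd_const_mul (h1.fun_mul h2), pd_score_mul_rpow hs hφ hpos β hθ]

end ObservationTerm

variable {Θ s : Set (E p)} {β : ℝ} {θ₀ : E p}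

lemma integral_density (hmodel : IsParametricModel Θ μ f) (hθ : θ ∈ Θ) :
    ∫ x, f θ x ∂μ = 1 := by
  have := hmodel.isProbabilityMeasure θ hθ
  have h := integral_modelMeasure (μ := μ) (hmodel.measurable θ hθ) (hmodel.nonneg θ hθ) fun _ => 1
  simpa using h.symm

/-- For `β = 0` the term is zero, while the integral on the right is the total mass `1`; only the
derivatives agree. -/
lemma pd_integralTerm (hmodel : IsParametricModel Θ μ f) (hs : IsOpen s) (hsΘ : s ⊆ Θ)
    (hθ : θ ∈ s) (i : Fin p) :
    pd i (integralTerm μ f β) θ = pd i (fun t => ∫ x, f t x ^ (1 + β) ∂μ) θ := by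
  by_cases hβ : β = 0
  · have h1 : integralTerm μ f β = fun _ => 0 := by
      funext t
      simp [integralTerm, hβ]
    rw [h1, pd_const, pd_congr_of_eqOn hs (F' := fun _ => 1) (fun t ht => ?_) hθ, pd_const]
    simpa [hβ] using integral_density hmodel (hsΘ ht)
  · have h1 : integralTerm μ f β = fun t => ∫ x, f t x ^ (1 + β) ∂μ := by
      funext t
      simp [integralTerm, hβ]
    rw [h1]

lemma thriceDifferentiableOn_integralTerm
    (hF : ThriceDiffUnderIntegral μ (fun θ x => f θ x ^ (1 + β)) s) :
    ThriceDifferentiableOn (integralTerm μ f β) s := by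
  by_cases hβ : β = 0
  · have h1 : integralTerm μ f β = fun _ => 0 := by
      funext t
      simp [integralTerm, hβ]
    have h2 : ∀ l : Fin p, pd l (fun _ : E p => (0 : ℝ)) = fun _ => 0 := fun l => by
      funext t
      exact pd_const 0 t l
    rw [h1]
    exact ⟨differentiableOn_const _, fun l => by rw [h2]; exact differentiableOn_const _,
      fun k l => by rw [h2, h2]; exact differentiableOn_const _⟩
  · have h1 : integralTerm μ f β = fun t => ∫ x, f t x ^ (1 + β) ∂μ := by
      funext t
      simp [integralTerm, hβ]
    rw [h1]
    exact ⟨hF.differentiable₁, hF.differentiable₂, hF.differentiable₃⟩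

lemma measurable_V (hf : Measurable (f θ)) : Measurable (V μ f β θ) := by
  unfold V
  split_ifs
  · exact (Real.measurable_log.comp hf).neg
  · exact measurable_const.sub ((hf.pow_const β).const_mul _)

lemma rpow_mul_self {a β : ℝ} (hβ : 0 ≤ β) (ha : 0 ≤ a) : a ^ β * a = a ^ (1 + β) := by
  rcases ha.eq_or_lt with rfl | h
  · rw [mul_zero, Real.zero_rpow (by positivity)]
  · rw [add_comm, Real.rpow_add h, Real.rpow_one]

/-- The normalised density power divergence criterion is regular at `θ₀`: its gradient has
covariance `K_β(θ₀)` and its mean Hessian is `J_β(θ₀)`. -/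
lemma exists_regularCriterion (hmodel : IsParametricModel Θ μ f) (hβ : 0 ≤ β)
    (hsupp : ∀ θ ∈ Θ, {x | 0 < f θ x} = {x | 0 < f θ₀ x})
    (hs : IsOpen s) (hsΘ : s ⊆ Θ) (hθ₀ : θ₀ ∈ s)
    (hsmooth : ∀ᵐ x ∂μ, 0 < f θ₀ x → ContDiffOn ℝ 3 (fun θ => f θ x) s)
    (hF : ThriceDiffUnderIntegral μ (fun θ x => f θ x ^ (1 + β)) s)
    (hG : ThriceDiffUnderIntegral μ (fun θ x => f θ x ^ β * f θ₀ x) s)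
    {M : Fin p → Fin p → Fin p → 𝒳 → ℝ}
    (hM : ∀ᵐ x ∂μ, 0 < f θ₀ x → ∀ θ ∈ s, ∀ j k l,
      |pd j (pd k (pd l (fun t => V μ f β t x))) θ| ≤ M j k l x)
    (hMint : ∀ j k l, Integrable (M j k l) (modelMeasure μ f θ₀))
    (hK : ∀ i j, Integrable
      (fun x => score f θ₀ x i * score f θ₀ x j * f θ₀ x ^ (1 + 2 * β)) μ) :
    ∃ ρ z H b, Metric.ball θ₀ ρ ⊆ s ∧
      RegularCriterion (modelMeasure μ f θ₀) (fun x θ => (1 + β)⁻¹ * V μ f β θ x) θ₀ ρ z H b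
        (Matrix.toEuclideanCLM (𝕜 := ℝ) (J μ f β θ₀)) ∧
      ∀ i j, ∫ x, z x i * z x j ∂modelMeasure μ f θ₀ = K μ f β θ₀ i j := by
  have hfm := hmodel.measurable θ₀ (hsΘ hθ₀)
  have hf0 := hmodel.nonneg θ₀ (hsΘ hθ₀)
  have hprob := hmodel.isProbabilityMeasure θ₀ (hsΘ hθ₀)
  set ν := modelMeasure μ f θ₀ with hν
  have hβ1 : 0 < 1 + β := by positivity
  obtain ⟨ρ, hρ, hball⟩ := Metric.isOpen_iff.1 hs θ₀ hθ₀
  have hpos : ∀ x, 0 < f θ₀ x → ∀ θ ∈ s, 0 < f θ x := fun x hx θ hθ => by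
    have : x ∈ {x | 0 < f θ x} := by rw [hsupp θ (hsΘ hθ)]; exact hx
    exact this
  -- Off the common support all powers `f ^ (1 + β)` vanish identically in `θ`, so the derivative
  -- formulas below hold for `μ`-almost every `x` and may be integrated against `μ`.
  have hzero : ∀ x, f θ₀ x = 0 → ∀ θ ∈ s, f θ x = 0 := fun x hx θ hθ => by
    refine le_antisymm (not_lt.1 fun h => ?_) (hmodel.nonneg θ (hsΘ hθ) x)
    have : x ∈ {x | 0 < f θ₀ x} := by rw [← hsupp θ (hsΘ hθ)]; exact h
    exact absurd (show 0 < f θ₀ x from this) (by rw [hx]; exact lt_irrefl 0)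
  let u : Fin p → 𝒳 → ℝ := fun i x => score f θ₀ x i
  let h : Fin p → Fin p → 𝒳 → ℝ := fun i j x => pd j (pd i fun t => Real.log (f t x)) θ₀
  have hpow0 : ∀ x, f θ₀ x = 0 → f θ₀ x ^ (1 + β) = 0 := fun x hx => by
    rw [hx, Real.zero_rpow hβ1.ne']
  have hnull : ∀ x, f θ₀ x = 0 → ∀ t ∈ s, f t x ^ (1 + β) = 0 := fun x hx t ht => by
    rw [hzero x hx t ht, Real.zero_rpow hβ1.ne']
  have E1 : ∀ᵐ x ∂μ, ∀ i, pd i (fun t => f t x ^ (1 + β)) θ₀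
      = (1 + β) * (u i x * f θ₀ x ^ (1 + β)) := by
    filter_upwards [hsmooth] with x hx i
    rcases (hf0 x).eq_or_lt with h0 | h0
    · rw [pd_congr_of_eqOn hs (hnull x h0.symm) hθ₀, pd_const, hpow0 x h0.symm]
      simp
    · exact pd_rpow hs (hx h0) (hpos x h0) _ hθ₀ i
  have E2 : ∀ᵐ x ∂μ, ∀ i j, pd j (pd i fun t => f t x ^ (1 + β)) θ₀
      = (1 + β) * ((h i j x + (1 + β) * (u i x * u j x)) * f θ₀ x ^ (1 + β)) := by
    filter_upwards [hsmooth] with x hx i j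
    rcases (hf0 x).eq_or_lt with h0 | h0
    · rw [pd_congr_of_eqOn hs (F' := fun _ => 0) (fun t ht => by
        rw [pd_congr_of_eqOn hs (hnull x h0.symm) ht, pd_const]) hθ₀, pd_const, hpow0 x h0.symm]
      simp
    · exact pd_pd_rpow hs (hx h0) (hpos x h0) _ hθ₀ i j
  have E3 : ∀ᵐ x ∂μ, ∀ i j, pd j (pd i fun t => f t x ^ β * f θ₀ x) θ₀
      = β * ((h i j x + β * (u i x * u j x)) * f θ₀ x ^ (1 + β)) := by
    filter_upwards [hsmooth] with x hx i j
    rcases (hf0 x).eq_or_lt with h0 | h0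
    · have h1 : (fun t => f t x ^ β * f θ₀ x) = fun _ => 0 := by
        funext t
        rw [← h0, mul_zero]
      have h2 : pd i (fun _ : E p => (0 : ℝ)) = fun _ => 0 := funext fun t => pd_const 0 t i
      rw [h1, h2, pd_const, hpow0 x h0.symm]
      simp
    · have ht := ThriceDifferentiableOn.of_contDiffOn hs
        (contDiffOn_rpow_const (hx h0) (hpos x h0) β)
      have h1 : (fun t => f t x ^ β * f θ₀ x) = fun t => f θ₀ x * f t x ^ β :=
        funext fun t => mul_comm _ _
      rw [h1, pd_congr_of_eqOn hs (fun t hts => pd_const_mul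
          (ht.differentiableOn.differentiableAt (hs.mem_nhds hts)) _ i) hθ₀,
        pd_const_mul ((ht.pd i).differentiableAt (hs.mem_nhds hθ₀)),
        pd_pd_rpow hs (hx h0) (hpos x h0) β hθ₀, ← rpow_mul_self hβ h0.le]
      change _ * (β * ((h i j x + β * (u i x * u j x)) * _)) = _
      ring
  have I1 : ∀ i, Integrable (fun x => u i x * f θ₀ x ^ (1 + β)) μ := fun i => by
    refine ((hF.integrable₁ θ₀ hθ₀ i).const_mul (1 + β)⁻¹).congr ?_
    filter_upwards [E1] with x hx
    rw [hx i, inv_mul_cancel_left₀ hβ1.ne']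
  have I2 : ∀ i j, Integrable
      (fun x => (h i j x + (1 + β) * (u i x * u j x)) * f θ₀ x ^ (1 + β)) μ := fun i j => by
    refine ((hF.integrable₂ θ₀ hθ₀ j i).const_mul (1 + β)⁻¹).congr ?_
    filter_upwards [E2] with x hx
    rw [hx i j, inv_mul_cancel_left₀ hβ1.ne']
  -- For `β > 0` this is a second derivative of `f_θ^β f_θ₀`. For `β = 0` that function does not
  -- vary with `θ` on the support, and the finiteness of the integrals in `K` takes its place.
  have IA : ∀ i j, Integrable
      (fun x => (h i j x + β * (u i x * u j x)) * f θ₀ x ^ (1 + β)) μ := fun i j => by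
    by_cases hβ0 : β = 0
    · refine ((I2 i j).sub (hK i j)).congr (ae_of_all _ fun x => ?_)
      simp only [hβ0, Pi.sub_apply, u]
      norm_num
      ring
    · refine ((hG.integrable₂ θ₀ hθ₀ j i).const_mul β⁻¹).congr ?_
      filter_upwards [E3] with x hx
      rw [hx i j, inv_mul_cancel_left₀ hβ0]
  have IU : ∀ i j, Integrable (fun x => u i x * u j x * f θ₀ x ^ (1 + β)) μ := fun i j =>
    ((I2 i j).sub (IA i j)).congr (ae_of_all _ fun x => by
      simp only [Pi.sub_apply]
      ring)
  let ξ : Fin p → ℝ := xi μ f β θ₀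
  let D : Fin p → Fin p → ℝ := fun i j =>
    (1 + β)⁻¹ * pd j (pd i fun t => ∫ x, f t x ^ (1 + β) ∂μ) θ₀
  have hξ : ∀ i, pd i (fun t => ∫ x, f t x ^ (1 + β) ∂μ) θ₀ = (1 + β) * ξ i := fun i => by
    rw [hF.deriv₁ θ₀ hθ₀ i, integral_congr_ae (E1.mono fun x hx => hx i), integral_const_mul]
    rfl
  -- The coefficients `1 + β` and `β` of the score product differ by one, and this difference is
  -- exactly `J`. Subtracting the mean of the observation part of the Hessian therefore leaves `J`.
  have hD : ∀ i j, D i j = (∫ x, (h i j x + β * (u i x * u j x)) * f θ₀ x ^ (1 + β) ∂μ)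
      + J μ f β θ₀ i j := fun i j => by
    have h1 : J μ f β θ₀ i j = ∫ x, u i x * u j x * f θ₀ x ^ (1 + β) ∂μ := rfl
    simp only [D]
    rw [h1, ← integral_add (IA i j) (IU i j), hF.deriv₂ θ₀ hθ₀ j i,
      integral_congr_ae (E2.mono fun x hx => hx i j), integral_const_mul,
      inv_mul_cancel_left₀ hβ1.ne']
    exact integral_congr_ae (ae_of_all _ fun x => by ring)
  let a : Fin p → 𝒳 → ℝ := fun i x => u i x * f θ₀ x ^ β
  have ha : ∀ i, MemLp (a i) 2 ν := fun i => by
    -- Measurability is inherited from the integrable `u f^(1+β)` by dividing by `f`, which is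
    -- positive almost everywhere for `ν`.
    have hm : AEStronglyMeasurable (a i) ν := by
      have hac : ν ≪ μ := withDensity_absolutelyContinuous _ _
      have h1 : AEStronglyMeasurable (fun x => u i x * f θ₀ x ^ (1 + β) / f θ₀ x) ν :=
        (((I1 i).aestronglyMeasurable.mono_ac hac).aemeasurable.div
          hfm.aemeasurable).aestronglyMeasurable
      refine h1.congr ((ae_modelMeasure_iff hfm).2 (ae_of_all _ fun x hx => ?_))
      simp only [a]
      rw [← rpow_mul_self hβ hx.le]
      field_simp
    refine (memLp_two_iff_integrable_sq hm).2 ((integrable_modelMeasure_iff hfm hf0).2 ?_)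
    refine (hK i i).congr (ae_of_all _ fun x => ?_)
    simp only [a, u]
    rw [show 1 + 2 * β = 1 + (β + β) by ring, ← rpow_mul_self (by positivity) (hf0 x),
      Real.rpow_add_of_nonneg (hf0 x) hβ hβ]
    ring
  have hamean : ∀ i, ∫ x, a i x ∂ν = ξ i := fun i => by
    rw [integral_modelMeasure hfm hf0]
    refine integral_congr_ae (ae_of_all _ fun x => ?_)
    simp only [a]
    rw [mul_assoc, rpow_mul_self hβ (hf0 x)]
  have hacov : ∀ i j, ∫ x, a i x * a j x ∂ν
      = ∫ x, score f θ₀ x i * score f θ₀ x j * f θ₀ x ^ (1 + 2 * β) ∂μ := fun i j => by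
    rw [integral_modelMeasure hfm hf0]
    refine integral_congr_ae (ae_of_all _ fun x => ?_)
    simp only [a, u]
    rw [show 1 + 2 * β = 1 + (β + β) by ring, ← rpow_mul_self (by positivity) (hf0 x),
      Real.rpow_add_of_nonneg (hf0 x) hβ hβ]
    ring
  have ha1 : ∀ i, Integrable (a i) ν := fun i => (ha i).integrable (by norm_num)
  let m : 𝒳 → Fin p → Fin p → ℝ := fun x l k =>
    D l k - (h l k x + β * (u l x * u k x)) * f θ₀ x ^ β
  have hmI : ∀ l k, Integrable (fun x => (h l k x + β * (u l x * u k x)) * f θ₀ x ^ β) ν :=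
    fun l k => by
      refine (integrable_modelMeasure_iff hfm hf0).2 ((IA l k).congr (ae_of_all _ fun x => ?_))
      simp only
      rw [mul_assoc, rpow_mul_self hβ (hf0 x)]
  have hmint : ∀ l k, Integrable (fun x => m x l k) ν := fun l k =>
    (integrable_const _).sub (hmI l k)
  have hmmean : ∀ l k, ∫ x, m x l k ∂ν = J μ f β θ₀ l k := fun l k => by
    simp only [m]
    rw [integral_sub (integrable_const _) (hmI l k), integral_const, probReal_univ, one_smul,
      hD l k, integral_modelMeasure hfm hf0, add_sub_right_comm, sub_eq_zero.2, zero_add]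
    refine integral_congr_ae (ae_of_all _ fun x => ?_)
    dsimp only
    rw [mul_assoc, rpow_mul_self hβ (hf0 x)]
  -- A continuous linear map from arrays to operators reduces the integrability and the mean of the
  -- Hessian to its entries.
  let L : (Fin p → Fin p → ℝ) →L[ℝ] (E p →L[ℝ] E p) := LinearMap.toContinuousLinearMap
    ((Matrix.toEuclideanCLM (n := Fin p) (𝕜 := ℝ)).toAlgEquiv.toLinearMap
      ∘ₗ (Matrix.ofLinearEquiv ℝ).toLinearMap)
  have hL : ∀ A, L A = Matrix.toEuclideanCLM (𝕜 := ℝ) (Matrix.of A) := fun A => rfl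
  have hmint' : Integrable m ν := Integrable.of_eval fun l => Integrable.of_eval fun k => hmint l k
  refine ⟨ρ, fun x => WithLp.toLp 2 fun i => ξ i - a i x, fun x => L (m x),
    fun x => (1 + β)⁻¹ • ∑ l, ∑ k, ∑ j, M j k l x, hball,
    ⟨hρ, ?_, ?_, ?_, L.integrable_comp hmint', ?_, ?_⟩, ?_⟩
  · refine (ae_modelMeasure_iff hfm).2 ?_
    filter_upwards [hsmooth, hM] with x hx hMx h0
    have hw := ThriceDifferentiableOn.of_contDiffOn hs
      (contDiffOn_observationTerm (β := β) (hx h0) (hpos x h0))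
    have hc := thriceDifferentiableOn_integralTerm hF
    have hV := hc.sub hs hw
    rw [← V_eq] at hV
    have hq := (quadApprox_of_third_derivative_bound hρ (hV.differentiableOn.mono hball)
      (fun l => (hV.pd l).mono hball) (fun k l => (hV.pd_pd k l).mono hball)
      (B := fun j k l => M j k l x) (fun θ hθ => hMx h0 θ (hball hθ))).const_mul
      (c := (1 + β)⁻¹) (by positivity)
    convert! hq using 1
    · ext i
      simp only [grad, PiLp.smul_apply, smul_eq_mul]
      rw [V_eq, hc.pd_sub hs hw hθ₀, pd_observationTerm hs (hx h0) (hpos x h0) hθ₀,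
        pd_integralTerm hmodel hs hsΘ hθ₀, hξ, ← mul_sub, inv_mul_cancel_left₀ hβ1.ne']
      rfl
    · rw [hL, ← map_smul]
      congr 1
      ext l k
      simp only [Matrix.of_apply, Matrix.smul_apply, smul_eq_mul]
      rw [V_eq, hc.pd_pd_sub hs hw hθ₀, pd_pd_observationTerm hs (hx h0) (hpos x h0) hθ₀,
        pd_congr_of_eqOn hs (fun t ht => pd_integralTerm hmodel hs hsΘ ht l) hθ₀, mul_sub,
        inv_mul_cancel_left₀ hβ1.ne']
      rfl
  · exact MemLp.of_eval_piLp fun i => (memLp_const _).sub (ha i)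
  · intro j
    simp only
    rw [integral_sub (integrable_const _) (ha1 j), hamean]
    simp
  · rw [L.integral_comp_comm hmint', hL]
    congr 1
    ext l k
    rw [Matrix.of_apply, eval_integral fun l => Integrable.of_eval fun k => hmint l k,
      eval_integral fun k => hmint l k, hmmean]
  · exact (integrable_finsetSum _ fun l _ => integrable_finsetSum _ fun k _ =>
      integrable_finsetSum _ fun j _ => hMint j k l).const_mul _
  · intro i j
    simp only
    have h1 : ∀ x, (ξ i - a i x) * (ξ j - a j x)
        = ξ i * ξ j - ξ i * a j x - ξ j * a i x + a i x * a j x := fun x => by ring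
    simp_rw [h1]
    have h2 : Integrable (fun x => a i x * a j x) ν := (ha i).integrable_mul (ha j)
    rw [integral_add _ h2, integral_sub _ ((ha1 i).const_mul _),
      integral_sub (integrable_const _) ((ha1 j).const_mul _), integral_const,
      integral_const_mul, integral_const_mul, hamean, hamean, hacov]
    · change _ = (∫ x, score f θ₀ x i * score f θ₀ x j * f θ₀ x ^ (1 + 2 * β) ∂μ) - ξ i * ξ j
      rw [probReal_univ, one_smul]
      ring
    · exact (integrable_const _).sub ((ha1 j).const_mul _)
    · exact ((integrable_const _).sub ((ha1 j).const_mul _)).sub ((ha1 i).const_mul _)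

end Model

/-! ### Constraint set, normalised objective and existence of minimizers. -/

section Restricted

variable {p r : ℕ} {𝒳 : Type*} [MeasurableSpace 𝒳] {μ : Measure 𝒳} {f : E p → 𝒳 → ℝ}

lemma fderiv_eq_G_transpose_mulVec {g : E p → E r} {θ : E p} (hg : DifferentiableAt ℝ g θ)
    (x : E p) : fderiv ℝ g θ x = WithLp.toLp 2 ((G g θ).transpose.mulVec x.ofLp) := by
  ext j
  have h1 : fderiv ℝ (fun t => g t j) θ = (EuclideanSpace.proj j : E r →L[ℝ] ℝ).comp
      (fderiv ℝ g θ) :=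
    ((EuclideanSpace.proj j : E r →L[ℝ] ℝ).hasFDerivAt.comp θ hg.hasFDerivAt).fderiv
  have h2 : fderiv ℝ (fun t => g t j) θ x = fderiv ℝ g θ x j := by rw [h1]; rfl
  rw [← h2, fderiv_apply_eq_sum]
  simp [Matrix.mulVec, dotProduct, G, mul_comm]

lemma objective_eq_average {Ω : Type*} {β : ℝ} (hβ : 0 ≤ β) (X : ℕ → Ω → 𝒳) (n : ℕ) (w : Ω)
    (θ : E p) : objective μ f β (fun i : Fin n => X i w) θ
      = (1 + β) * average (fun x t => (1 + β)⁻¹ * V μ f β t x) X n w θ := by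
  have h : (1 + β) ≠ 0 := by positivity
  rw [objective, average, ← Finset.mul_sum, Finset.sum_range, one_div]
  field_simp

/-- The normalising factor `1 + β` is positive, so the two functions have the same minimizers. -/
lemma objective_le_iff_average_le {Ω : Type*} {β : ℝ} (hβ : 0 ≤ β) (X : ℕ → Ω → 𝒳) (n : ℕ)
    (w : Ω) (θ θ' : E p) :
    objective μ f β (fun i : Fin n => X i w) θ ≤ objective μ f β (fun i : Fin n => X i w) θ' ↔
      average (fun x t => (1 + β)⁻¹ * V μ f β t x) X n w θ
        ≤ average (fun x t => (1 + β)⁻¹ * V μ f β t x) X n w θ' := by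
  rw [objective_eq_average hβ, objective_eq_average hβ, mul_le_mul_iff_right₀ (by positivity)]

/-- The second moments of a linear image. -/
lemma integral_toEuclideanCLM_mul {ν : Measure 𝒳} {z : 𝒳 → E p} (hz : MemLp z 2 ν)
    {A S : Matrix (Fin p) (Fin p) ℝ} (hS : ∀ i j, ∫ x, z x i * z x j ∂ν = S i j) (i j : Fin p) :
    ∫ x, Matrix.toEuclideanCLM (𝕜 := ℝ) A (z x) i * Matrix.toEuclideanCLM (𝕜 := ℝ) A (z x) j ∂ν
      = (A * S * A.transpose) i j := by
  have hI : ∀ k l, Integrable (fun x => A i k * A j l * (z x k * z x l)) ν := fun k l =>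
    ((hz.eval_piLp k).integrable_mul (hz.eval_piLp l)).const_mul _
  have h1 : ∀ x, Matrix.toEuclideanCLM (𝕜 := ℝ) A (z x) i
      * Matrix.toEuclideanCLM (𝕜 := ℝ) A (z x) j
      = ∑ l, ∑ k, A i k * A j l * (z x k * z x l) := fun x => by
    simp only [Matrix.ofLp_toEuclideanCLM, Matrix.mulVec, dotProduct]
    rw [Finset.sum_mul_sum, Finset.sum_comm]
    exact Finset.sum_congr rfl fun _ _ => Finset.sum_congr rfl fun _ _ => by ring
  simp_rw [h1]
  rw [integral_finsetSum _ fun l _ => integrable_finsetSum _ fun k _ => hI k l]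
  simp_rw [integral_finsetSum _ fun k (_ : k ∈ Finset.univ) => hI k _, integral_const_mul, hS]
  simp only [Matrix.mul_apply, Finset.sum_mul, Matrix.transpose_apply]
  exact Finset.sum_congr rfl fun _ _ => Finset.sum_congr rfl fun _ _ => by ring

/-- The restricted space is closed relative to `Θ` only; a ball contained in `Θ` turns the
intersection into a closed subset of that ball. -/
lemma isCompact_restricted_inter_closedBall {Θ : Set (E p)} {g : E p → E r}
    (hg : ContinuousOn g Θ) {θ₀ : E p} {ρ : ℝ} (hρ : Metric.closedBall θ₀ ρ ⊆ Θ) :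
    IsCompact (restricted Θ g ∩ Metric.closedBall θ₀ ρ) := by
  have : restricted Θ g ∩ Metric.closedBall θ₀ ρ = Metric.closedBall θ₀ ρ ∩ g ⁻¹' {0} := by
    ext θ
    constructor
    · rintro ⟨⟨-, h⟩, hb⟩
      exact ⟨hb, h⟩
    · rintro ⟨hb, h⟩
      exact ⟨⟨hρ hb, h⟩, hb⟩
  rw [this]
  exact (isCompact_closedBall θ₀ ρ).of_isClosed_subset
    ((hg.mono hρ).preimage_isClosed_of_isClosed Metric.isClosed_closedBall isClosed_singleton)
    Set.inter_subset_left

/-- Measurable minimizers of the empirical objective over a compact set on which it is almost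
surely continuous. -/
lemma exists_measurable_minimizer {Θ C : Set (E p)} {β : ℝ}
    (hf : ∀ θ ∈ Θ, Measurable (f θ)) {ν : Measure 𝒳} (hC : IsCompact C) (hne : C.Nonempty)
    (hCΘ : C ⊆ Θ) (hcont : ∀ᵐ x ∂ν, ContinuousOn (fun θ => V μ f β θ x) C)
    {Ω : Type*} [MeasurableSpace Ω] {Pr : Measure Ω} {X : ℕ → Ω → 𝒳}
    (hX : ∀ i, Measurable (X i)) (hlaw : ∀ i, Pr.map (X i) = ν) :
    ∃ T : ∀ n : ℕ, (Fin n → 𝒳) → E p, (∀ n, Measurable (T n)) ∧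
      WithHighProbability Pr fun n w => T n (fun i => X i w) ∈ C ∧
        IsMinOn (objective μ f β (fun i : Fin n => X i w)) C (T n (fun i => X i w)) := by
  obtain ⟨A, hAν, hAm, hA⟩ := hcont.exists_measurable_mem
  have key : ∀ n : ℕ, ∃ T : (Fin n → 𝒳) → E p, Measurable T ∧ ∀ y : Fin n → 𝒳, T y ∈ C ∧
      IsMinOn (fun θ => (1 / (n : ℝ)) * ∑ i, A.indicator (fun x => V μ f β θ x) (y i)) C (T y) :=
    fun n => by
      refine exists_measurable_isMinOn hC hne (fun θ hθ => ?_) fun y => ?_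
      · exact (Finset.measurable_fun_sum _ fun i _ =>
          ((measurable_V (hf θ (hCΘ hθ))).indicator hAm).comp (measurable_pi_apply i)).const_mul _
      · refine continuousOn_const.mul (continuousOn_finsetSum _ fun i _ => ?_)
        by_cases hy : y i ∈ A
        · simpa [hy] using hA _ hy
        · simpa [hy] using continuousOn_const
  choose T hT hmin using key
  refine ⟨T, hT, WithHighProbability.of_ae fun n => ?_⟩
  have hgood : ∀ᵐ w ∂Pr, ∀ i, X i w ∈ A :=
    ae_all_iff.2 fun i => ae_of_ae_map (hX i).aemeasurable (by rw [hlaw i]; exact hAν)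
  filter_upwards [hgood] with w hw
  have h1 := hmin n fun i => X i w
  refine ⟨h1.1, ?_⟩
  have h2 : objective μ f β (fun i : Fin n => X i w)
      = fun θ => (1 / (n : ℝ)) * ∑ i : Fin n, A.indicator (fun x => V μ f β θ x) (X i w) := by
    funext θ
    simp [objective, hw]
  rw [h2]
  exact h1.2

end Restricted

end DPD

end

/-! ### Assembly of the main theorem. -/

theorem theorem2 {p r : ℕ} (hrp : r < p)
    {𝒳 : Type*} [MeasurableSpace 𝒳] (μ : Measure 𝒳) [SigmaFinite μ]
    (Θ : Set (DPD.E p)) (f : DPD.E p → 𝒳 → ℝ) (hmodel : DPD.IsParametricModel Θ μ f)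
    (g : DPD.E p → DPD.E r) (hg : ContDiffOn ℝ 1 g Θ)
    (hrank : ∀ θ ∈ Θ, (DPD.G g θ).rank = r)
    (β : ℝ) (hβ : 0 ≤ β)
    (θ₀ : DPD.E p) (hθ₀ : θ₀ ∈ DPD.restricted Θ g)
    (hLB : DPD.LehmannBasuConditions Θ μ f β θ₀)
    -- the integrals that define `K_β(θ₀)` exist
    (hK : ∀ i j, Integrable
      (fun x => DPD.score f θ₀ x i * DPD.score f θ₀ x j * f θ₀ x ^ (1 + 2 * β)) μ)
    {Ω : Type*} [MeasurableSpace Ω] (Pr : Measure Ω) [IsProbabilityMeasure Pr]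
    (X : ℕ → Ω → 𝒳) (hX : ∀ i, Measurable (X i)) (hindep : iIndepFun X Pr)
    (hlaw : ∀ i, Pr.map (X i) = DPD.modelMeasure μ f θ₀) :
    -- near `θ₀` restricted minimizers exist, and all of them are consistent and asymptotically
    -- normal
    (∃ ρ₀ > 0, ∀ ρ, 0 < ρ → ρ ≤ ρ₀ →
      (∃ T : ∀ n : ℕ, (Fin n → 𝒳) → DPD.E p, (∀ n, Measurable (T n)) ∧
        DPD.WithHighProbability Pr (fun n w =>
          T n (fun i => X i w) ∈ DPD.restricted Θ g ∩ Metric.closedBall θ₀ ρ ∧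
          IsMinOn (DPD.objective μ f β (fun i : Fin n => X i w))
            (DPD.restricted Θ g ∩ Metric.closedBall θ₀ ρ) (T n (fun i => X i w)))) ∧
      ∀ est : ℕ → Ω → DPD.E p, (∀ n, AEMeasurable (est n) Pr) →
        DPD.WithHighProbability Pr (fun n w =>
          est n w ∈ DPD.restricted Θ g ∩ Metric.closedBall θ₀ ρ ∧
          IsMinOn (DPD.objective μ f β (fun i : Fin n => X i w))
            (DPD.restricted Θ g ∩ Metric.closedBall θ₀ ρ) (est n w)) →
        TendstoInMeasure Pr est atTop (fun _ => θ₀) ∧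
        DPD.AsymptoticallyNormal Pr est θ₀ (DPD.asymptoticCov μ f β g θ₀)) ∧
    -- every consistent sequence of (local or global) restricted minimizers is asymptotically normal
    (∀ est : ℕ → Ω → DPD.E p, (∀ n, AEMeasurable (est n) Pr) →
      DPD.WithHighProbability Pr (fun n w =>
        est n w ∈ DPD.restricted Θ g ∧
        IsLocalMinOn (DPD.objective μ f β (fun i : Fin n => X i w))
          (DPD.restricted Θ g) (est n w)) →
      TendstoInMeasure Pr est atTop (fun _ => θ₀) →
      DPD.AsymptoticallyNormal Pr est θ₀ (DPD.asymptoticCov μ f β g θ₀)) := by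
  obtain ⟨s, hs, hsΘ, hθ₀s, hsmooth, hF, hG, M, hM, hMint⟩ := hLB.smooth
  obtain ⟨ρ₁, z, H, b, hball, hreg, hcov⟩ := DPD.exists_regularCriterion hmodel hβ
    hLB.common_support hs hsΘ hθ₀s hsmooth hF hG hM hMint hK
  have hgd : DifferentiableAt ℝ g θ₀ :=
    (hg.contDiffAt (hmodel.isOpen.mem_nhds hθ₀.1)).differentiableAt one_ne_zero
  obtain ⟨hPt, hPJ, hGQ, hGP⟩ := DPD.restricted_information hLB.posDef (hrank θ₀ hθ₀.1)
    (Q := DPD.Q μ f β g θ₀) rfl (P := DPD.P μ f β g θ₀) rfl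
  set P := DPD.P μ f β g θ₀
  set Q := DPD.Q μ f β g θ₀
  have hP : ∀ x y : DPD.E p, inner ℝ (Matrix.toEuclideanCLM (𝕜 := ℝ) P x) y
      = inner ℝ x (Matrix.toEuclideanCLM (𝕜 := ℝ) P y) := fun x y => by
    rw [Matrix.inner_toEuclideanCLM, ← real_inner_comm, Matrix.inner_toEuclideanCLM,
      Matrix.dotProduct_mulVec, ← Matrix.mulVec_transpose, hPt, dotProduct_comm]
  have normality : ∀ est : ℕ → Ω → DPD.E p, (∀ n, AEMeasurable (est n) Pr) →
      DPD.WithHighProbability Pr (fun n w =>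
        est n w ∈ DPD.restricted Θ g ∧
        IsLocalMinOn (DPD.objective μ f β (fun i : Fin n => X i w))
          (DPD.restricted Θ g) (est n w)) →
      TendstoInMeasure Pr est atTop (fun _ => θ₀) →
      DPD.AsymptoticallyNormal Pr est θ₀ (DPD.asymptoticCov μ f β g θ₀) := by
    intro est hmeas hest hcons
    refine hreg.asymptoticallyNormal hX hindep hlaw hmodel.isOpen hg hθ₀ hP
      (R := (Matrix.toEuclideanLin Q).toContinuousLinearMap) (fun x => ?_) (fun y => ?_)
      (fun x => ?_) (fun i j => ?_) hmeas (hest.mono fun n w hw => ⟨hw.1, ?_⟩) hcons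
    · rw [DPD.fderiv_eq_G_transpose_mulVec hgd, ← mul_apply_eq_comp, ← map_mul, hPJ]
      ext i
      simp
    · rw [DPD.fderiv_eq_G_transpose_mulVec hgd]
      ext i
      simp [hGQ]
    · rw [DPD.fderiv_eq_G_transpose_mulVec hgd]
      ext i
      simp [hGP]
    · rw [DPD.integral_toEuclideanCLM_mul hreg.memLp hcov, hPt]
      rfl
    · exact hw.2.mono fun θ hθ => (DPD.objective_le_iff_average_le hβ X n w _ _).1 hθ
  refine ⟨?_, normality⟩
  obtain ⟨c, hc, hJ⟩ := DPD.exists_quadratic_lower_bound hLB.posDef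
  have hbd : 0 < |∫ x, b x ∂DPD.modelMeasure μ f θ₀| + 1 := by positivity
  have hρ₁ := hreg.pos
  -- The first bound keeps the closed ball inside the ball of the quadratic approximation; the
  -- second makes the cubic error at most `c / 2 * ‖d‖ ^ 2`, as consistency requires.
  refine ⟨min (ρ₁ / 2) (c / 2 / (|∫ x, b x ∂DPD.modelMeasure μ f θ₀| + 1)), by positivity,
    fun ρ hρ hρle => ?_⟩
  have hρlt : ρ < ρ₁ := (hρle.trans (min_le_left _ _)).trans_lt (half_lt_self hρ₁)
  have hbρ : (|∫ x, b x ∂DPD.modelMeasure μ f θ₀| + 1) * ρ ≤ c / 2 := by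
    rw [mul_comm, ← le_div_iff₀ hbd]
    exact hρle.trans (min_le_right _ _)
  have hsub : Metric.closedBall θ₀ ρ ⊆ Metric.ball θ₀ ρ₁ := Metric.closedBall_subset_ball hρlt
  have hθ₀C : θ₀ ∈ DPD.restricted Θ g ∩ Metric.closedBall θ₀ ρ :=
    ⟨hθ₀, Metric.mem_closedBall_self hρ.le⟩
  constructor
  · refine DPD.exists_measurable_minimizer hmodel.measurable
      (DPD.isCompact_restricted_inter_closedBall hg.continuousOn
        (hsub.trans (hball.trans hsΘ))) ⟨θ₀, hθ₀C⟩ (fun θ hθ => hθ.1.1) ?_ hX hlaw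
    filter_upwards [hreg.approx] with x hx
    refine ((hx.contDiffOn.continuousOn.const_smul (1 + β)).mono
      (Set.inter_subset_right.trans hsub)).congr fun θ _ => ?_
    rw [Pi.smul_apply, smul_eq_mul, mul_inv_cancel_left₀ (by positivity)]
  · intro est hmeas hest
    have hcons : TendstoInMeasure Pr est atTop fun _ => θ₀ :=
      hreg.tendstoInMeasure hX hindep hlaw hc hJ hρlt hbρ (hest.mono fun n w hw =>
        ⟨hw.1.2, (DPD.objective_le_iff_average_le hβ X n w _ _).1 (isMinOn_iff.1 hw.2 _ hθ₀C)⟩)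
    refine ⟨hcons, normality est hmeas ?_ hcons⟩
    -- By consistency the minimizer lies in the open ball with high probability, so there it is a
    -- local minimizer over the whole restricted space.
    refine (hest.and (DPD.withHighProbability_of_tendstoInMeasure hcons hρ)).mono ?_
    rintro n w ⟨⟨hmem, hmin⟩, hdist⟩
    refine ⟨hmem.1, ?_⟩
    have h1 := hmin.localize
    unfold IsLocalMinOn at h1 ⊢
    rwa [nhdsWithin_inter_of_mem' (mem_nhdsWithin_of_mem_nhds (Filter.mem_of_superset
      (Metric.isOpen_ball.mem_nhds (mem_ball_iff_norm.2 hdist)) Metric.ball_subset_closedBall))]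
      at h1
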